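/- Let $G=(V,E)$ be a finite simple undirected graph and $M\subseteq E$ a matching. A vertex is free if no edge of $M$ is incident to it; $U$ is the set of free vertices. An alternating path is a simple path in which exactly one of any two consecutive edges lies in $M$; an augmenting path is an alternating path connecting two different free vertices. A shortest augmenting path is one of minimum length among all augmenting paths; this length, if there is an augmenting path, is written $2\ell+1$. **Distances.** Let $\hat G$ be obtained from $G$ by adding a new vertex $f$ and, for each $u\in U$, a new vertex $w_u$ with the edges $\{f,w_u\}$ (non-matching) and $\{w_u,u\}$ (matching). For $\theta\in\{\mathrm{odd},\mathrm{even}\}$ let $\mathrm{dist}^\theta(v)$ be the minimum length of an alternating path of parity $\theta$ from $f$ to $v$ in $\hat G$ ($\infty$ if there is none), and let $\bar\theta$ be the other parity. The orthodox parity of $v$ is the $\theta$ with $\mathrm{dist}^{\theta}(v)<\mathrm{dist}^{\bar\theta}(v)$; alternating paths from $f$ to $v$ of this parity are called orthodox. Let $\mathsf{P}(v)$ be the set of vertices $v'$ such that some shortest orthodox alternating path from $f$ to $v$ has last edge $\{v',v\}$. An edge $\{y,z\}$ is critical if $y\notin\mathsf P(z)$ and $z\notin\mathsf P(y)$. For an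 edge $e=\{y,z\}$ put $\rho(e)=\mathrm{odd}$ if $e$ is a matching edge and $\rho(e)=\mathrm{even}$ otherwise; its volume is $\mathrm{dist}^{\rho(e)}(y)+\mathrm{dist}^{\rho(e)}(z)+1$, its height is $\max\{\mathrm{dist}^{\rho(e)}(y),\mathrm{dist}^{\rho(e)}(z)\}$, and its level is the pair (volume, height), ordered lexicographically. **Alternating base trees.** An alternating base tree (ABT) $T$ is a tree rooted at $f$ on the vertices that can be reached from $f$ by alternating paths, obtained by choosing for each such $v\neq f$ a parent $\mathsf p_T(v)\in\mathsf P(v)$. $T(t)$ is the subtree rooted at $t$, and for $v\in V$ in $T$, $\mathsf r_T(v)$ is the vertex $u\in U$ with $v\in T(u)$. An incoming edge of $T(t)$ is an edge $\{y,z\}$ of $\hat G$ that is not an edge of $T$ and has $z\in T(t)$, $y\notin T(t)$; a minimum incoming edge (MIE) is one of minimum level. For each $t$ such that $T(t)$ has an incoming edge, fix an arbitrary MIE $e^*_T(t)$ of $T(t)$. **Double paths.** An edge $\{y,z\}$ of $G$ is crossable if its volume is $2\ell+5$ and $\mathsf r_T(y)\ne \mathsf r_T(z)$ for some ABT $T$.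 Let $E^*$ be the set of critical crossable edges ($E^*=\emptyset$ if there is no augmenting path). The alternating base DAG $H$ has vertex set $V$ and arcs $(u,v)$ for $u\in V\setminus U$, $v\in\mathsf P(u)$. A double path is a tuple $(P,Q,y,z)$ with $\{y,z\}\in E^*$ where $P,Q$ are vertex-disjoint paths in $H$ starting at $y$ and $z$, respectively, and ending at two distinct vertices of $U$. An ABT $T$ respects it if $T$ contains $P$ and $Q$. Two double paths are vertex-disjoint if they share no vertex. **Procedures.** $\textsc{PathConstruction}(T,s,t,\theta)$ is defined recursively: if $s=t$, it returns the trivial path $s$. Otherwise, if $\theta$ is the orthodox parity of $t$, it returns $\textsc{PathConstruction}(T,s,\mathsf p_T(t),\bar\theta)$ followed by the edge $\{\mathsf p_T(t),t\}$. Otherwise, with $e^*_T(t)=\{y,z\}=e$, $z\in T(t)$, it returns $\textsc{PathConstruction}(T,s,y,\rho(e))$, followed by the edge $\{y,z\}$, followed by the reversal of $\textsc{PathConstruction}(T,t,z,\rho(e))$. $\textsc{DoubleToAug}(P,Q,y,z)$, with respect to an ABT $T$ respecting $(P,Q,y,z)$, returns $\textsc{PathConstruction}(T,\mathsf r_T(y),y,\rho(\{y,z\}))$,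 followed by $\{y,z\}$, followed by the reversal of $\textsc{PathConstruction}(T,\mathsf r_T(z),z,\rho(\{y,z\}))$. **Theorem.** Let $\mathcal D$ be an (inclusion-wise) maximal set of vertex-disjoint double paths. Then there is an ABT respecting all members of $\mathcal D$. Moreover, for every such ABT $T$ and every choice of the MIEs $e^*_T(t)$, the procedure $\textsc{DoubleToAug}$ with respect to $T$ terminates on every member of $\mathcal D$ with a path of $G$ as output, and the set $\mathsf{Aug}(\mathcal D)$ of these outputs is an (inclusion-wise) maximal set of vertex-disjoint shortest augmenting paths of $(G,M)$. -/

import Mathlib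

/-- A matching system: a simple undirected graph together with a matching in it. -/
structure MatchingSystem (V : Type*) where
  graph : SimpleGraph V
  matching : graph.Subgraph
  isMatching : matching.IsMatching

/-- The two parities of the length of an alternating path. -/
inductive PathParity where
  | odd
  | even

namespace PathParity

/-- The other parity. -/
def flip : PathParity → PathParity
  | odd => even
  | even => odd

/-- The number `n` has parity `θ`. -/
def Holds : PathParity → ℕ → Prop
  | odd, n => Odd n
  | even, n => Even n

end PathParity

namespace MatchingSystem

variable {V : Type*} (I : MatchingSystem V)

/-- The set `U` of free vertices. -/
def free : Set V := {v | v ∉ I.matching.verts}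

/-! ### Augmenting paths -/

/-- A (simple) path on which exactly one of any two consecutive edges is in the matching. -/
def IsAlternatingPath {u v : V} (p : I.graph.Walk u v) : Prop :=
  p.IsPath ∧ p.edges.IsChain fun e e' => Xor (e ∈ I.matching.edgeSet) (e' ∈ I.matching.edgeSet)

/-- An alternating path connecting two different free vertices. -/
def IsAugmentingPath {u v : V} (p : I.graph.Walk u v) : Prop :=
  I.IsAlternatingPath p ∧ u ≠ v ∧ u ∈ I.free ∧ v ∈ I.free

/-- An augmenting path whose length is minimum among all augmenting paths. -/
def IsShortestAugmentingPath {u v : V} (p : I.graph.Walk u v) : Prop :=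
  I.IsAugmentingPath p ∧
    ∀ (u' v' : V) (p' : I.graph.Walk u' v'), I.IsAugmentingPath p' → p.length ≤ p'.length

/-! ### Adding the super free vertex -/

/-- The vertices after adding the super free vertex `root`, joined to every free vertex `u` by a
path of length two with middle vertex `mid u`. -/
inductive ExtVertex where
  | orig (v : V)
  | mid (u : I.free)
  | root

/-- Adjacency in the extended graph. -/
def ExtAdj : I.ExtVertex → I.ExtVertex → Prop
  | .orig u, .orig v => I.graph.Adj u v
  | .orig v, .mid u => v = u
  | .mid u, .orig v => v = u
  | .mid _, .root => True
  | .root, .mid _ => True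
  | _, _ => False

/-- Adjacency by a matching edge of the extended system: the edge between a free vertex `u` and
`mid u` is a matching edge, the edge between `mid u` and `root` is not. -/
def ExtMatchingAdj : I.ExtVertex → I.ExtVertex → Prop
  | .orig u, .orig v => I.matching.Adj u v
  | .orig v, .mid u => v = u
  | .mid u, .orig v => v = u
  | _, _ => False

/-- The extended graph. -/
def ext : SimpleGraph I.ExtVertex where
  Adj := I.ExtAdj
  symm := ⟨by
    rintro (u | u | _) (v | v | _) h <;> first | exact h | exact I.graph.adj_symm h⟩
  loopless := ⟨by
    rintro (u | u | _) h <;> first | exact h | exact I.graph.loopless.irrefl u h⟩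

/-- The matching of the extended graph. -/
def extMatching : SimpleGraph I.ExtVertex where
  Adj := I.ExtMatchingAdj
  symm := ⟨by
    rintro (u | u | _) (v | v | _) h <;> first | exact h | exact I.matching.adj_symm h⟩
  loopless := ⟨by
    rintro (u | u | _) h <;>
      first | exact h | exact I.graph.loopless.irrefl u (I.matching.adj_sub h)⟩

/-- The inclusion of the original graph into the extended graph. -/
def origHom : I.graph →g I.ext where
  toFun := .orig
  map_rel' h := h

/-- Alternating paths of the extended system. -/
def IsExtAlternatingPath {a b : I.ExtVertex} (p : I.ext.Walk a b) : Prop :=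
  p.IsPath ∧
    p.edges.IsChain fun e e' => Xor (e ∈ I.extMatching.edgeSet) (e' ∈ I.extMatching.edgeSet)

/-! ### Distances, orthodox parity, alternating base trees -/

/-- The length of a shortest alternating path of parity `θ` from the super free vertex to `a`
(`⊤` if there is none). -/
noncomputable def dist (θ : PathParity) (a : I.ExtVertex) : ℕ∞ :=
  ⨅ (p : I.ext.Walk .root a) (_ : I.IsExtAlternatingPath p ∧ θ.Holds p.length), (p.length : ℕ∞)

/-- `θ` is the orthodox parity of `a`. -/
def IsOrthodox (θ : PathParity) (a : I.ExtVertex) : Prop :=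
  I.dist θ a < I.dist θ.flip a

/-- A shortest orthodox alternating path from the super free vertex to `a`. -/
def IsShortestOrthodoxPath {a : I.ExtVertex} (p : I.ext.Walk .root a) : Prop :=
  I.IsExtAlternatingPath p ∧
    ∃ θ : PathParity, I.IsOrthodox θ a ∧ θ.Holds p.length ∧ (p.length : ℕ∞) = I.dist θ a

/-- The set of those `b` for which some shortest orthodox alternating path to `a` has `{b, a}` as
its last edge. -/
def parents (a : I.ExtVertex) : Set I.ExtVertex :=
  {b | ∃ (q : I.ext.Walk .root b) (h : I.ext.Adj b a), I.IsShortestOrthodoxPath (q.concat h)}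

open Classical in
/-- The parity that an alternating path must have to be extended by the edge `{a, b}`. -/
noncomputable def rho (a b : I.ExtVertex) : PathParity :=
  if I.extMatching.Adj a b then .odd else .even

/-- The volume of the edge `{a, b}`. -/
noncomputable def volume (a b : I.ExtVertex) : ℕ∞ :=
  I.dist (I.rho a b) a + I.dist (I.rho a b) b + 1

/-- The height of the edge `{a, b}`. -/
noncomputable def height (a b : I.ExtVertex) : ℕ∞ :=
  max (I.dist (I.rho a b) a) (I.dist (I.rho a b) b)

/-- An alternating base tree. Every vertex `a` other than the super free vertex that is reached by
some alternating path from the super free vertex (equivalently, `parents a` is nonempty) chooses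
its parent in `parents a`; the value of `parent` at the other vertices is irrelevant. -/
structure ABT where
  parent : I.ExtVertex → I.ExtVertex
  parent_mem : ∀ a, (I.parents a).Nonempty → parent a ∈ I.parents a

/-! ### The alternating base DAG, crossable edges, double paths -/

/-- The alternating base DAG: its vertices are those of the original graph, and each vertex that is
not free has an arc to each of its possible parents. -/
def baseDAG : Digraph V where
  Adj u v := u ∉ I.free ∧ (.orig v : I.ExtVertex) ∈ I.parents (.orig u)

end MatchingSystem

namespace MatchingSystem.ABT

variable {V : Type*} {I : MatchingSystem V} (T : I.ABT)

/-- `b` is the parent of `a` in the tree. -/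
def IsParent (a b : I.ExtVertex) : Prop :=
  (I.parents a).Nonempty ∧ T.parent a = b

/-- `T.subtree t` is the vertex set of the subtree rooted at `t`. -/
def subtree (t : I.ExtVertex) : Set I.ExtVertex :=
  {a | Relation.ReflTransGen T.IsParent a t}

/-- `u` is the root of the tree containing `v` in the forest that is left after removing the super
free vertex and its neighbours. -/
def IsRootOf (u v : V) : Prop :=
  u ∈ I.free ∧ (.orig v : I.ExtVertex) ∈ T.subtree (.orig u)

/-- `{y, z}` is an incoming edge of the subtree rooted at `t`, with its endpoint `z` inside: an edge
between the outside and the inside of the subtree that is not an edge of the tree. -/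
def IsIncoming (t y z : I.ExtVertex) : Prop :=
  I.ext.Adj y z ∧ z ∈ T.subtree t ∧ y ∉ T.subtree t ∧ ¬ T.IsParent y z ∧ ¬ T.IsParent z y

/-- `{y, z}` is a minimum incoming edge of the subtree rooted at `t`, with its endpoint `z` inside:
an incoming edge of minimum level, levels being compared by volume and then by height. -/
def IsMIE (t y z : I.ExtVertex) : Prop :=
  T.IsIncoming t y z ∧ ∀ y' z', T.IsIncoming t y' z' →
    I.volume y z < I.volume y' z' ∨
      (I.volume y z = I.volume y' z' ∧ I.height y z ≤ I.height y' z')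

/-- A choice of a canonical minimum incoming edge `m t = (y, z)`, with `z` inside, of the subtree
rooted at `t`, for each `t` such that this subtree has an incoming edge. -/
def IsMIEChoice (m : I.ExtVertex → I.ExtVertex × I.ExtVertex) : Prop :=
  ∀ t, (∃ y z, T.IsIncoming t y z) → T.IsMIE t (m t).1 (m t).2

/-- The recursive procedure PathConstruction for the tree `T` and the canonical minimum incoming
edges `m`: `T.PathConstruction m s t θ p` says that it halts on the input `(s, t, θ)` with
output `p`. -/
inductive PathConstruction (m : I.ExtVertex → I.ExtVertex × I.ExtVertex) :
    (s t : I.ExtVertex) → PathParity → I.ext.Walk s t → Prop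
  | base (s : I.ExtVertex) (θ : PathParity) :
      PathConstruction m s s θ .nil
  | orthodox (s t : I.ExtVertex) (θ : PathParity) (X : I.ext.Walk s (T.parent t))
      (hst : s ≠ t) (hθ : I.IsOrthodox θ t) (h : I.ext.Adj (T.parent t) t)
      (hX : PathConstruction m s (T.parent t) θ.flip X) :
      PathConstruction m s t θ (X.concat h)
  | unorthodox (s t y z : I.ExtVertex) (θ : PathParity) (Y : I.ext.Walk s y) (Z : I.ext.Walk t z)
      (hst : s ≠ t) (hθ : ¬ I.IsOrthodox θ t) (hm : m t = (y, z)) (h : I.ext.Adj y z)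
      (hY : PathConstruction m s y (I.rho y z) Y)
      (hZ : PathConstruction m t z (I.rho y z) Z) :
      PathConstruction m s t θ (Y.append (.cons h Z.reverse))

end MatchingSystem.ABT

namespace MatchingSystem

variable {V : Type*} (I : MatchingSystem V)

/-- The edge `{y, z}` of the original graph is crossable: its volume is `2 * ℓ + 5`, where
`2 * ℓ + 1` is the length of the shortest augmenting paths, and its endpoints have different roots
in some alternating base tree. -/
def IsCrossable (y z : V) : Prop :=
  I.graph.Adj y z ∧
  (∃ ℓ : ℕ,
    (∃ (u v : V) (p : I.graph.Walk u v), I.IsShortestAugmentingPath p ∧ p.length = 2 * ℓ + 1) ∧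
    I.volume (.orig y) (.orig z) = ((2 * ℓ + 5 : ℕ) : ℕ∞)) ∧
  ∃ (T : I.ABT) (u v : V), T.IsRootOf u y ∧ T.IsRootOf v z ∧ u ≠ v

/-- The edge `{y, z}` is critical: it is the last edge of no shortest orthodox alternating path. -/
def IsCritical (y z : V) : Prop :=
  (.orig y : I.ExtVertex) ∉ I.parents (.orig z) ∧ (.orig z : I.ExtVertex) ∉ I.parents (.orig y)

/-- A double path: two vertex-disjoint paths of the alternating base DAG from the two endpoints of a
critical crossable edge `{y, z}` to two distinct free vertices `u` and `v`. -/
structure DoublePath where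
  y : V
  z : V
  u : V
  v : V
  P : I.graph.Walk y u
  Q : I.graph.Walk z v
  crossable : I.IsCrossable y z
  critical : I.IsCritical y z
  isPath_P : P.IsPath
  isPath_Q : Q.IsPath
  dag_P : ∀ d ∈ P.darts, I.baseDAG.Adj d.fst d.snd
  dag_Q : ∀ d ∈ Q.darts, I.baseDAG.Adj d.fst d.snd
  u_free : u ∈ I.free
  v_free : v ∈ I.free
  u_ne_v : u ≠ v
  disjoint : ∀ x, x ∈ P.support → x ∉ Q.support

variable {I}

/-- The vertices of a double path. -/
def DoublePath.verts (d : I.DoublePath) : Set V := {x | x ∈ d.P.support ∨ x ∈ d.Q.support}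

/-- The alternating base tree `T` respects the double path `d`: it contains both paths of `d`. -/
def ABT.Respects (T : I.ABT) (d : I.DoublePath) : Prop :=
  (∀ e ∈ d.P.darts, T.IsParent (.orig e.fst) (.orig e.snd)) ∧
  ∀ e ∈ d.Q.darts, T.IsParent (.orig e.fst) (.orig e.snd)

variable (I)

/-- Walks of the original graph, with arbitrary endpoints. -/
structure AnyWalk where
  src : V
  tgt : V
  walk : I.graph.Walk src tgt

variable {I}

/-- The vertices of a walk. -/
def AnyWalk.verts (q : I.AnyWalk) : Set V := {x | x ∈ q.walk.support}

/-- The procedure DoubleToAug for the tree `T` and the canonical minimum incoming edges `m` halts on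
the double path `d` with output `q`. -/
def DoubleToAug (T : I.ABT) (m : I.ExtVertex → I.ExtVertex × I.ExtVertex) (d : I.DoublePath)
    (q : I.AnyWalk) : Prop :=
  T.IsRootOf q.src d.y ∧ T.IsRootOf q.tgt d.z ∧
  ∃ (Y : I.ext.Walk (.orig q.src) (.orig d.y)) (Z : I.ext.Walk (.orig q.tgt) (.orig d.z))
    (h : I.ext.Adj (.orig d.y) (.orig d.z)),
    T.PathConstruction m (.orig q.src) (.orig d.y) (I.rho (.orig d.y) (.orig d.z)) Y ∧
    T.PathConstruction m (.orig q.tgt) (.orig d.z) (I.rho (.orig d.y) (.orig d.z)) Z ∧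
    q.walk.map I.origHom = Y.append (.cons h Z.reverse)

/-- The set of the outputs of DoubleToAug on the members of `D`. -/
def Aug (T : I.ABT) (m : I.ExtVertex → I.ExtVertex × I.ExtVertex) (D : Set I.DoublePath) :
    Set I.AnyWalk :=
  {q | ∃ d ∈ D, DoubleToAug T m d q}

variable (I)

/-- `D` is a set of vertex-disjoint double paths. -/
def IsDisjointDoublePaths (D : Set I.DoublePath) : Prop :=
  D.PairwiseDisjoint DoublePath.verts

/-- `A` is a set of vertex-disjoint shortest augmenting paths. -/
def IsDisjointShortestAugmentingPaths (A : Set I.AnyWalk) : Prop :=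
  (∀ q ∈ A, I.IsShortestAugmentingPath q.walk) ∧ A.PairwiseDisjoint AnyWalk.verts

end MatchingSystem

/-! Write K = 2ℓ+5: a shortest augmenting path plus the stems of length two from the super free
vertex to its two ends. Call the sum of the two distances of a vertex its tenacity.

Correctness of the procedure. If θ is unorthodox at t, a shortest θ-path to t enters T(t) a last
time, over an edge of volume at most the tenacity of t and of height below the θ-distance
(`exists_incoming`). So the MIE is at least as good, and routing through it costs no more than a
shortest path. The two recursive halves do not meet: they only use MIEs of smaller level, hence
cannot cross into a subtree all of whose incoming edges have at least the level of that MIE. This is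
`exists_pathConstruction`, an induction on the level bound and then on the distance. Its main
consequence is `tenacity_le_of_isIncoming`. Free vertices have tenacity at least K, so for a
critical edge of volume K both halves stay in the disjoint trees of their free ends, and joining
them gives length 2ℓ+1.

Maximality. For a vertex x let c be the first vertex of tenacity at least K on the tree path from x
to the root, x included. Every shortest augmenting path through x also contains c
(`IsThread.mem_support_of_mem_bag`), because edges leaving the set of vertices with the same c have
volume at least K. If x is on a double path, c is on its output too. So a shortest augmenting path
avoiding all outputs avoids all double paths. Redirecting the tree along that path keeps the tree
respecting the double paths, and exposes a critical edge of volume K between the trees of its two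
ends (`exists_critical_edge`). Tree paths from that edge form one more disjoint double path, against
the maximality of 𝒟. -/

/-! ### Alternation by position along a walk, and cutting walks at a set. -/

namespace SimpleGraph.Walk

variable {X : Type*} {G : SimpleGraph X}

/-- The `i`-th edge of the walk belongs to `E` if and only if `n + i` is odd. -/
def Alternates (E : Set (Sym2 X)) : ℕ → {a b : X} → G.Walk a b → Prop
  | _, _, _, .nil => True
  | n, _, _, .cons (u := a) (v := b) _ p => (s(a, b) ∈ E ↔ n % 2 = 1) ∧ Alternates E (n + 1) p

@[simp] lemma alternates_nil (E : Set (Sym2 X)) (n : ℕ) (a : X) :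
    (nil : G.Walk a a).Alternates E n := trivial

@[simp] lemma alternates_cons {E : Set (Sym2 X)} {n : ℕ} {a b c : X} (h : G.Adj a b)
    (p : G.Walk b c) :
    (cons h p).Alternates E n ↔ (s(a, b) ∈ E ↔ n % 2 = 1) ∧ p.Alternates E (n + 1) := Iff.rfl

lemma Alternates.congr {E : Set (Sym2 X)} {a b : X} {p : G.Walk a b} :
    ∀ {n m : ℕ}, p.Alternates E n → n % 2 = m % 2 → p.Alternates E m := by
  induction p with
  | nil => simp
  | cons h p ih =>
    intro n m hp hnm
    exact ⟨by rw [hp.1, hnm], ih hp.2 (by omega)⟩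

lemma alternates_append {E : Set (Sym2 X)} {a b c : X} (p : G.Walk a b) (q : G.Walk b c) :
    ∀ {n : ℕ}, (p.append q).Alternates E n ↔
      p.Alternates E n ∧ q.Alternates E (n + p.length) := by
  induction p with
  | nil => simp
  | cons h p ih =>
    intro n
    rw [cons_append, alternates_cons, alternates_cons, ih, and_assoc, length_cons,
      show n + 1 + p.length = n + (p.length + 1) by omega]

lemma alternates_concat {E : Set (Sym2 X)} {a b c : X} (p : G.Walk a b) (h : G.Adj b c) {n : ℕ} :
    (p.concat h).Alternates E n ↔
      p.Alternates E n ∧ (s(b, c) ∈ E ↔ (n + p.length) % 2 = 1) := by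
  rw [concat_eq_append, alternates_append]; simp

lemma Alternates.reverse {E : Set (Sym2 X)} {a b : X} {p : G.Walk a b} :
    ∀ {n m : ℕ}, p.Alternates E n → (n + p.length + m) % 2 = 1 → p.reverse.Alternates E m := by
  induction p with
  | nil => simp
  | @cons a b c h p ih =>
    intro n m hp hnm
    rw [length_cons] at hnm
    rw [reverse_cons, ← concat_eq_append, alternates_concat]
    refine ⟨ih hp.2 (by omega), ?_⟩
    rw [Sym2.eq_swap, hp.1, length_reverse]
    omega

lemma Alternates.map {Y : Type*} {G' : SimpleGraph Y} {E : Set (Sym2 X)} {E' : Set (Sym2 Y)}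
    (f : G →g G') (hf : ∀ a b, s(f a, f b) ∈ E' ↔ s(a, b) ∈ E) {a b : X} (p : G.Walk a b) :
    ∀ {n : ℕ}, (p.map f).Alternates E' n ↔ p.Alternates E n := by
  induction p with
  | nil => simp
  | cons h p ih => intro n; simp [ih, hf]

lemma alternates_getVert {E : Set (Sym2 X)} {a b : X} {p : G.Walk a b} :
    ∀ {n : ℕ}, p.Alternates E n → ∀ {i : ℕ}, i < p.length →
      (s(p.getVert i, p.getVert (i + 1)) ∈ E ↔ (n + i) % 2 = 1) := by
  induction p with
  | nil => simp
  | @cons a b c h p ih =>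
    intro n hp i hi
    rw [length_cons] at hi
    rcases i with _ | i
    · simpa using hp.1
    · rw [getVert_cons_succ, getVert_cons_succ, ih hp.2 (by omega),
        show n + 1 + i = n + (i + 1) by omega]

/-- Once the first edge is classified, all later ones are forced, so only the phase n is free. -/
lemma edges_isChain_xor_iff {E : Set (Sym2 X)} {a b : X} (p : G.Walk a b) :
    (p.edges.IsChain fun e e' => Xor (e ∈ E) (e' ∈ E)) ↔ ∃ n, p.Alternates E n := by
  induction p with
  | nil => simp
  | @cons a b c h p ih =>
    have h0 : ∃ n, (s(a, b) ∈ E ↔ n % 2 = 1) := by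
      by_cases hE : s(a, b) ∈ E
      · exact ⟨1, by simp [hE]⟩
      · exact ⟨0, by simp [hE]⟩
    cases p with
    | nil => simpa using h0
    | @cons _ d _ h' p =>
      rw [edges_cons, edges_cons, List.isChain_cons_cons, ← edges_cons h' p, ih]
      constructor
      · rintro ⟨hx, n, hn⟩
        -- The head has phase n - 1; n + 1 has the same parity and avoids subtraction.
        refine ⟨n + 1, ?_, hn.congr (by omega)⟩
        have h1 := hn.1
        rcases hx with ⟨h2, h3⟩ | ⟨h2, h3⟩
        · simp only [h3, h2, false_iff, true_iff] at h1 ⊢; omega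
        · simp only [h3, h2, false_iff, true_iff] at h1 ⊢; omega
      · rintro ⟨n, h1, h2⟩
        refine ⟨?_, n + 1, h2⟩
        have h3 := h2.1
        by_cases hE : s(a, b) ∈ E
        · refine Or.inl ⟨hE, fun h4 => ?_⟩
          have := h1.1 hE; have := h3.1 h4; omega
        · refine Or.inr ⟨h3.2 ?_, hE⟩
          have : ¬ n % 2 = 1 := fun h => hE (h1.2 h)
          omega

lemma isPath_append_iff {a b c : X} (p : G.Walk a b) (q : G.Walk b c) :
    (p.append q).IsPath ↔
      p.IsPath ∧ q.IsPath ∧ ∀ x, x ∈ p.support → x ∈ q.support → x = b := by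
  have hq : q.support = b :: q.support.tail := q.cons_tail_support.symm
  rw [isPath_def, isPath_def, isPath_def, support_append, List.nodup_append']
  constructor
  · rintro ⟨h1, h2, h3⟩
    refine ⟨h1, ?_, fun x hp hx => ?_⟩
    · rw [hq]
      exact List.nodup_cons.2 ⟨fun h => h3 p.end_mem_support h, h2⟩
    · rw [hq] at hx
      rcases List.mem_cons.1 hx with h | h
      · exact h
      · exact absurd h (h3 hp)
  · rintro ⟨h1, h2, h3⟩
    refine ⟨h1, h2.tail, fun x hp hx => ?_⟩
    obtain rfl := h3 x hp (List.mem_of_mem_tail hx)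
    rw [hq] at h2
    exact (List.nodup_cons.1 h2).1 hx

/-- The first edge by which a walk leaves a set. -/
lemma exists_first_exit (S : Set X) {a b : X} (p : G.Walk a b) (ha : a ∈ S) (hb : b ∉ S) :
    ∃ (y z : X) (q : G.Walk a y) (h : G.Adj y z) (r : G.Walk z b),
      p = q.append (cons h r) ∧ z ∉ S ∧ ∀ x ∈ q.support, x ∈ S := by
  induction p with
  | nil => exact absurd ha hb
  | @cons a c b h p ih =>
    by_cases hc : c ∈ S
    · obtain ⟨y, z, q, h', r, rfl, hz, hq⟩ := ih hc hb
      refine ⟨y, z, cons h q, h', r, rfl, hz, fun x hx => ?_⟩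
      rcases List.mem_cons.1 (by simpa using hx) with rfl | h1
      · exact ha
      · exact hq x h1
    · exact ⟨a, c, nil, h, p, rfl, hc, by simpa using ha⟩

/-- The last edge by which a walk enters a set. -/
lemma exists_last_entry (S : Set X) {a b : X} (p : G.Walk a b) (ha : a ∉ S) (hb : b ∈ S) :
    ∃ (y z : X) (q : G.Walk a y) (h : G.Adj y z) (r : G.Walk z b),
      p = q.append (cons h r) ∧ y ∉ S ∧ ∀ x ∈ r.support, x ∈ S := by
  obtain ⟨z, y, q, h, r, hp, hy, hq⟩ := exists_first_exit S p.reverse hb ha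
  refine ⟨y, z, r.reverse, h.symm, q.reverse, ?_, hy, by simpa using hq⟩
  rw [← p.reverse_reverse, hp, reverse_append, reverse_cons, ← append_assoc]
  rfl

/-- The first vertex of a walk in a set. -/
lemma exists_first_mem (S : Set X) {a b : X} (p : G.Walk a b) (hb : b ∈ S) :
    ∃ (w : X) (q : G.Walk a w) (r : G.Walk w b),
      p = q.append r ∧ w ∈ S ∧ ∀ x ∈ q.support, x ∈ S → x = w := by
  induction p with
  | nil => exact ⟨_, nil, nil, rfl, hb, by simp⟩
  | @cons a c b h p ih =>
    by_cases ha : a ∈ S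
    · exact ⟨a, nil, cons h p, rfl, ha, by simp⟩
    · obtain ⟨w, q, r, rfl, hw, hq⟩ := ih hb
      refine ⟨w, cons h q, r, rfl, hw, fun x hx hxS => ?_⟩
      rcases List.mem_cons.1 (by simpa using hx) with rfl | h1
      · exact absurd hxS ha
      · exact hq x h1 hxS

end SimpleGraph.Walk

/-! ### Parities of numbers. -/

namespace PathParity

/-- The parity of a natural number. -/
def ofNat (n : ℕ) : PathParity := if n % 2 = 1 then odd else even

lemma holds_iff {θ : PathParity} {n : ℕ} : θ.Holds n ↔ θ = ofNat n := by
  unfold ofNat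
  cases θ <;> simp only [Holds, Nat.odd_iff, Nat.even_iff] <;> split_ifs <;> simp <;> omega

lemma ofNat_eq_ofNat {n m : ℕ} : ofNat n = ofNat m ↔ n % 2 = m % 2 := by
  unfold ofNat
  split_ifs <;> simp <;> omega

@[simp] lemma flip_ofNat (n : ℕ) : (ofNat n).flip = ofNat (n + 1) := by
  unfold ofNat
  split_ifs <;> simp [flip] <;> omega

@[simp] lemma flip_flip (θ : PathParity) : θ.flip.flip = θ := by cases θ <;> rfl

lemma flip_ne (θ : PathParity) : θ.flip ≠ θ := by cases θ <;> simp [flip]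

end PathParity

/-! ### Distances, tenacity and parents. -/

namespace MatchingSystem

open PathParity (ofNat ofNat_eq_ofNat)
open SimpleGraph SimpleGraph.Walk

variable {V : Type*} {I : MatchingSystem V}

/-- There is an alternating path of length `n` from the super free vertex to `a`. -/
def Reach (I : MatchingSystem V) (a : I.ExtVertex) (n : ℕ) : Prop :=
  ∃ p : I.ext.Walk .root a, p.IsPath ∧ p.Alternates I.extMatching.edgeSet 0 ∧ p.length = n

/-- No matching edge is incident to the super free vertex, so the phase must be even. -/
lemma isExtAlternatingPath_iff {a : I.ExtVertex} (p : I.ext.Walk .root a) :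
    I.IsExtAlternatingPath p ↔ p.IsPath ∧ p.Alternates I.extMatching.edgeSet 0 := by
  unfold IsExtAlternatingPath
  rw [edges_isChain_xor_iff]
  refine and_congr_right fun _ => ⟨?_, fun h => ⟨_, h⟩⟩
  rintro ⟨n, hn⟩
  cases p with
  | nil => simp
  | @cons _ b _ h p =>
    have h1 : s(ExtVertex.root, b) ∉ I.extMatching.edgeSet := by
      rw [SimpleGraph.mem_edgeSet]; exact fun h => h
    refine hn.congr ?_
    have := hn.1
    simp only [h1, false_iff] at this
    omega

lemma Reach.dist_le {a : I.ExtVertex} {n : ℕ} (h : I.Reach a n) : I.dist (ofNat n) a ≤ n := by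
  obtain ⟨p, hp, ha, rfl⟩ := h
  exact iInf₂_le p ⟨(isExtAlternatingPath_iff p).2 ⟨hp, ha⟩, PathParity.holds_iff.2 rfl⟩

lemma reach_of_dist_eq {a : I.ExtVertex} {θ : PathParity} {n : ℕ} (h : I.dist θ a = n) :
    I.Reach a n ∧ θ = ofNat n := by
  -- An infimum below n + 1 has a term below n + 1, so the distance is attained.
  have h1 : I.dist θ a < (n + 1 : ℕ) := by rw [h]; exact_mod_cast Nat.lt_succ_self n
  unfold dist at h1
  obtain ⟨p, hp⟩ := iInf_lt_iff.1 h1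
  obtain ⟨hpp, hl⟩ := iInf_lt_iff.1 hp
  have h3 : p.length < n + 1 := by exact_mod_cast hl
  have h2 : I.dist θ a ≤ p.length := iInf₂_le p hpp
  rw [h] at h2
  have h4 : n ≤ p.length := by exact_mod_cast h2
  have h5 : p.length = n := by omega
  rw [isExtAlternatingPath_iff, PathParity.holds_iff, h5] at hpp
  exact ⟨⟨p, hpp.1.1, hpp.1.2, h5⟩, hpp.2⟩

/-- The length of a shortest orthodox path. -/
noncomputable def orthDist (I : MatchingSystem V) (a : I.ExtVertex) : ℕ∞ :=
  min (I.dist .odd a) (I.dist .even a)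

/-- The sum of the two distances of a vertex. -/
noncomputable def tenacity (I : MatchingSystem V) (a : I.ExtVertex) : ℕ∞ :=
  I.dist .odd a + I.dist .even a

lemma orthDist_eq (θ : PathParity) (a : I.ExtVertex) :
    I.orthDist a = min (I.dist θ a) (I.dist θ.flip a) := by
  cases θ
  · rfl
  · exact min_comm _ _

lemma tenacity_eq (θ : PathParity) (a : I.ExtVertex) :
    I.tenacity a = I.dist θ a + I.dist θ.flip a := by
  cases θ
  · rfl
  · exact add_comm _ _

lemma orthDist_le_dist (θ : PathParity) (a : I.ExtVertex) : I.orthDist a ≤ I.dist θ a := by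
  rw [orthDist_eq θ]; exact min_le_left _ _

lemma Reach.orthDist_le {a : I.ExtVertex} {n : ℕ} (h : I.Reach a n) : I.orthDist a ≤ n :=
  (orthDist_le_dist _ a).trans h.dist_le

lemma reach_of_orthDist_eq {a : I.ExtVertex} {n : ℕ} (h : I.orthDist a = n) :
    I.Reach a n ∧ I.dist (ofNat n) a = n := by
  rcases min_choice (I.dist .odd a) (I.dist .even a) with h1 | h1
  all_goals
    have h2 := h1.symm.trans h
    obtain ⟨h3, h4⟩ := reach_of_dist_eq h2
    rw [h4] at h2
    exact ⟨h3, h2⟩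

lemma dist_ne_dist_flip {a : I.ExtVertex} {θ : PathParity} {n : ℕ} (h : I.dist θ a = n) :
    I.dist θ.flip a ≠ n := by
  intro h1
  exact PathParity.flip_ne θ ((reach_of_dist_eq h1).2.trans (reach_of_dist_eq h).2.symm)

/-- Finite distances of opposite parities cannot tie, so every reached vertex has an orthodox
parity. -/
lemma isOrthodox_of_orthDist_eq {a : I.ExtVertex} {n : ℕ} (h : I.orthDist a = n) :
    I.IsOrthodox (ofNat n) a := by
  have h1 := (reach_of_orthDist_eq h).2
  refine lt_of_le_of_ne ?_ ?_
  · rw [h1, ← h]; exact orthDist_le_dist _ a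
  · rw [h1]; exact (dist_ne_dist_flip h1).symm

lemma IsOrthodox.dist_eq {a : I.ExtVertex} {θ : PathParity} (h : I.IsOrthodox θ a) :
    I.dist θ a = I.orthDist a := by
  rw [orthDist_eq θ, min_eq_left (le_of_lt h)]

lemma isOrthodox_flip {a : I.ExtVertex} {θ : PathParity} {n : ℕ} (h : ¬ I.IsOrthodox θ a)
    (hn : I.dist θ a = n) : I.IsOrthodox θ.flip a := by
  unfold IsOrthodox at *
  rw [PathParity.flip_flip]
  refine lt_of_le_of_ne (not_lt.1 h) ?_
  rw [hn]
  exact dist_ne_dist_flip hn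

lemma exists_unorthodox_dist {a : I.ExtVertex} {θ : PathParity} {n : ℕ} (h : ¬ I.IsOrthodox θ a)
    (hn : I.dist θ a = n) :
    ∃ k : ℕ, I.orthDist a = k ∧ θ.flip = ofNat k ∧ k < n ∧ I.tenacity a = (n + k : ℕ) := by
  have h1 := isOrthodox_flip h hn
  have h2 : I.dist θ.flip a < n := by
    have := h1
    unfold IsOrthodox at this
    rwa [PathParity.flip_flip, hn] at this
  obtain ⟨k, hk⟩ := ENat.ne_top_iff_exists.1 (ne_top_of_lt h2)
  refine ⟨k, by rw [← h1.dist_eq, hk], (reach_of_dist_eq hk.symm).2, ?_, ?_⟩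
  · rw [← hk] at h2; exact_mod_cast h2
  · rw [tenacity_eq θ, hn, ← hk]; push_cast; rfl

lemma rho_eq_ofNat {a b : I.ExtVertex} {n : ℕ} :
    I.rho a b = ofNat n ↔ (s(a, b) ∈ I.extMatching.edgeSet ↔ n % 2 = 1) := by
  unfold rho ofNat
  rw [SimpleGraph.mem_edgeSet]
  split_ifs <;> simp_all

lemma rho_comm (a b : I.ExtVertex) : I.rho a b = I.rho b a := by
  unfold rho
  rw [I.extMatching.adj_comm]

lemma volume_comm (a b : I.ExtVertex) : I.volume a b = I.volume b a := by
  unfold volume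
  rw [rho_comm, add_comm (I.dist (I.rho b a) a)]

lemma height_comm (a b : I.ExtVertex) : I.height a b = I.height b a := by
  unfold height
  rw [rho_comm, max_comm]

lemma reach_of_append {a b : I.ExtVertex} {p : I.ext.Walk .root a} {q : I.ext.Walk a b}
    (hp : (p.append q).IsPath) (ha : (p.append q).Alternates I.extMatching.edgeSet 0) :
    I.Reach a p.length :=
  ⟨p, hp.of_append_left, ((alternates_append p q).1 ha).1, rfl⟩

lemma orthDist_le_of_mem {a x : I.ExtVertex} {p : I.ext.Walk .root a}
    (hp : p.IsPath) (ha : p.Alternates I.extMatching.edgeSet 0) (hx : x ∈ p.support) :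
    I.orthDist x ≤ p.length := by
  obtain ⟨q, r, rfl⟩ := mem_support_iff_exists_append.1 hx
  refine (reach_of_append hp ha).orthDist_le.trans ?_
  rw [length_append]
  exact_mod_cast Nat.le_add_right _ _

lemma orthDist_lt_of_mem {a x : I.ExtVertex} {p : I.ext.Walk .root a}
    (hp : p.IsPath) (ha : p.Alternates I.extMatching.edgeSet 0) (hx : x ∈ p.support)
    (hxa : x ≠ a) : I.orthDist x < p.length := by
  obtain ⟨q, r, rfl⟩ := mem_support_iff_exists_append.1 hx
  refine (reach_of_append hp ha).orthDist_le.trans_lt ?_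
  rw [length_append]
  have : r.length ≠ 0 := fun h => hxa (Walk.eq_of_length_eq_zero h)
  exact_mod_cast (by omega)

/-- If b is already on the path, a prefix reaches it, but with unknown parity; hence the bound on
`orthDist` only. -/
lemma Reach.extend {a b : I.ExtVertex} {n : ℕ} (ha : I.Reach a n) (h : I.ext.Adj a b)
    (hr : I.rho a b = ofNat n) : I.orthDist b ≤ n ∨ I.Reach b (n + 1) := by
  obtain ⟨p, hp, hal, rfl⟩ := ha
  by_cases hb : b ∈ p.support
  · exact Or.inl (orthDist_le_of_mem hp hal hb)
  · refine Or.inr ⟨p.concat h, hp.concat hb h, ?_, by simp⟩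
    rw [alternates_concat]
    exact ⟨hal, by simpa using rho_eq_ofNat.1 hr⟩

lemma Reach.orthDist_le_succ {a b : I.ExtVertex} {n : ℕ} (ha : I.Reach a n) (h : I.ext.Adj a b)
    (hr : I.rho a b = ofNat n) : I.orthDist b ≤ (n + 1 : ℕ) := by
  rcases ha.extend h hr with h1 | h1
  · exact h1.trans (by exact_mod_cast Nat.le_succ n)
  · exact h1.orthDist_le

/-- Being a parent depends on distances only. A shorter way to b of the same parity would bring a
closer by `Reach.orthDist_le_succ`; conversely a path of length n to b cannot contain a, whose
orthodox distance is n + 1, so it can be extended to a. -/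
lemma mem_parents_iff {a b : I.ExtVertex} :
    b ∈ I.parents a ↔ ∃ n : ℕ, I.ext.Adj b a ∧ I.rho b a = ofNat n ∧ I.dist (ofNat n) b = n ∧
      I.orthDist a = (n + 1 : ℕ) := by
  constructor
  · rintro ⟨q, h, hq, θ, ho, hθ, hd⟩
    rw [isExtAlternatingPath_iff, concat_isPath_iff, alternates_concat] at hq
    obtain ⟨⟨hq, haq⟩, hal, hE⟩ := hq
    rw [length_concat] at hd
    rw [zero_add] at hE
    have hr := rho_eq_ofNat.2 hE
    have hor : I.orthDist a = (q.length + 1 : ℕ) := by rw [← ho.dist_eq, ← hd]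
    have hb : I.Reach b q.length := ⟨q, hq, hal, rfl⟩
    refine ⟨q.length, h, hr, le_antisymm hb.dist_le ?_, hor⟩
    obtain ⟨m, hm⟩ := ENat.ne_top_iff_exists.1 (ne_top_of_le_ne_top (by simp) hb.dist_le)
    obtain ⟨h1, h2⟩ := reach_of_dist_eq hm.symm
    have h3 := h1.orthDist_le_succ h (hr.trans h2)
    rw [hor] at h3
    rw [← hm]
    have : q.length + 1 ≤ m + 1 := by exact_mod_cast h3
    exact_mod_cast (by omega)
  · rintro ⟨n, h, hr, hd, ho⟩
    obtain ⟨⟨q, hq, hal, hl⟩, -⟩ := reach_of_dist_eq hd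
    have haq : a ∉ q.support := fun hm => by
      have := orthDist_le_of_mem hq hal hm
      rw [ho, hl] at this
      have : n + 1 ≤ n := by exact_mod_cast this
      omega
    refine ⟨q, h, ?_, ofNat (n + 1), isOrthodox_of_orthDist_eq ho, ?_, ?_⟩
    · rw [isExtAlternatingPath_iff, alternates_concat]
      exact ⟨hq.concat haq h, hal, by rw [zero_add, hl]; exact rho_eq_ofNat.1 hr⟩
    · rw [PathParity.holds_iff, length_concat, hl]
    · rw [(reach_of_orthDist_eq ho).2, length_concat, hl]

lemma mem_parents_of_reach {a b : I.ExtVertex} {n : ℕ} (hb : I.Reach b n) (h : I.ext.Adj b a)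
    (hr : I.rho b a = ofNat n) (ha : (n + 1 : ℕ) ≤ I.orthDist a) : b ∈ I.parents a := by
  refine mem_parents_iff.2 ⟨n, h, hr, le_antisymm hb.dist_le ?_,
    le_antisymm (hb.orthDist_le_succ h hr) ha⟩
  obtain ⟨m, hm⟩ := ENat.ne_top_iff_exists.1 (ne_top_of_le_ne_top (by simp) hb.dist_le)
  obtain ⟨h1, h2⟩ := reach_of_dist_eq hm.symm
  have h3 := ha.trans (h1.orthDist_le_succ h (hr.trans h2))
  rw [← hm]
  have : n + 1 ≤ m + 1 := by exact_mod_cast h3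
  exact_mod_cast (by omega)

lemma parents_nonempty {a : I.ExtVertex} (ha : I.orthDist a ≠ ⊤) (hr : a ≠ .root) :
    (I.parents a).Nonempty := by
  obtain ⟨n, hn⟩ := ENat.ne_top_iff_exists.1 ha
  obtain ⟨⟨p, hp, hal, hl⟩, -⟩ := reach_of_orthDist_eq hn.symm
  cases p with
  | nil => exact absurd rfl hr
  | cons h p =>
    obtain ⟨b, q, h', he⟩ := exists_cons_eq_concat h p
    rw [he] at hp hal hl
    rw [concat_isPath_iff] at hp
    rw [alternates_concat, zero_add] at hal
    rw [length_concat] at hl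
    exact ⟨b, mem_parents_of_reach ⟨q, hp.1, hal.1, rfl⟩ h' (rho_eq_ofNat.2 hal.2)
      (by rw [← hn, hl])⟩

lemma reach_root : I.Reach .root 0 := ⟨.nil, by simp, by simp, rfl⟩

lemma parents_root : I.parents .root = ∅ := by
  refine Set.eq_empty_of_forall_notMem fun b hb => ?_
  obtain ⟨n, -, -, -, h⟩ := mem_parents_iff.1 hb
  have h1 := (reach_root (I := I)).orthDist_le
  rw [h] at h1
  have : n + 1 ≤ 0 := by exact_mod_cast h1
  omega

/-- The distance n of the parent plus 1 is the orthodox distance of the child; the other summand is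
the child's unorthodox distance. -/
lemma volume_of_mem_parents {a b : I.ExtVertex} (h : b ∈ I.parents a) :
    I.volume b a = I.tenacity a := by
  obtain ⟨n, -, hr, hb, ha⟩ := mem_parents_iff.1 h
  have h1 := (reach_of_orthDist_eq ha).2
  unfold volume
  rw [hr, hb, tenacity_eq (ofNat n), PathParity.flip_ofNat, h1]
  push_cast
  ring

/-- Only the trivial path ends at its own start, so the odd distance is infinite. Hence every tree
path reaches a vertex of tenacity at least any given bound. -/
lemma tenacity_root : I.tenacity .root = ⊤ := by
  by_contra h
  have h1 : I.dist .odd (.root : I.ExtVertex) ≠ ⊤ := by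
    intro h2; exact h (by unfold tenacity; simp [h2])
  obtain ⟨n, hn⟩ := ENat.ne_top_iff_exists.1 h1
  obtain ⟨⟨p, hp, -, hl⟩, h2⟩ := reach_of_dist_eq hn.symm
  rw [isPath_iff_nil, ← eq_nil_iff_nil] at hp
  subst hp
  simp at hl
  subst hl
  simp [ofNat] at h2

end MatchingSystem

/-! ### Levels, subtrees and minimum incoming edges. -/

namespace MatchingSystem

open PathParity (ofNat ofNat_eq_ofNat)
open SimpleGraph SimpleGraph.Walk

variable {V : Type*} {I : MatchingSystem V}

/-- The level of an edge. -/
noncomputable def level (y z : I.ExtVertex) : ℕ∞ ×ₗ ℕ∞ := toLex (I.volume y z, I.height y z)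

lemma level_comm (y z : I.ExtVertex) : I.level y z = I.level z y := by
  unfold level
  rw [volume_comm, height_comm]

lemma exists_dist_of_volume_ne_top {y z : I.ExtVertex} (h : I.volume y z ≠ ⊤) :
    ∃ a c : ℕ, I.dist (I.rho y z) y = a ∧ I.dist (I.rho y z) z = c ∧ I.Reach y a ∧ I.Reach z c ∧
      I.rho y z = ofNat a ∧ I.rho y z = ofNat c ∧ I.volume y z = (a + c + 1 : ℕ) := by
  have h1 : I.dist (I.rho y z) y ≠ ⊤ := fun h1 => h (by unfold volume; simp [h1])
  have h2 : I.dist (I.rho y z) z ≠ ⊤ := fun h1 => h (by unfold volume; simp [h1])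
  obtain ⟨a, ha⟩ := ENat.ne_top_iff_exists.1 h1
  obtain ⟨c, hc⟩ := ENat.ne_top_iff_exists.1 h2
  obtain ⟨h3, h4⟩ := reach_of_dist_eq ha.symm
  obtain ⟨h5, h6⟩ := reach_of_dist_eq hc.symm
  refine ⟨a, c, ha.symm, hc.symm, h3, h5, h4, h6, ?_⟩
  unfold volume
  rw [← ha, ← hc]
  push_cast
  rfl

namespace ABT

variable {T : I.ABT}

lemma IsParent.mem_parents {a b : I.ExtVertex} (h : T.IsParent a b) : b ∈ I.parents a := by
  obtain ⟨h1, rfl⟩ := h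
  exact T.parent_mem a h1

lemma IsParent.adj {a b : I.ExtVertex} (h : T.IsParent a b) : I.ext.Adj b a := by
  obtain ⟨n, h, -⟩ := mem_parents_iff.1 h.mem_parents
  exact h

lemma IsParent.orthDist_lt {a b : I.ExtVertex} (h : T.IsParent a b) :
    I.orthDist b < I.orthDist a := by
  obtain ⟨n, -, -, hb, ha⟩ := mem_parents_iff.1 h.mem_parents
  rw [ha]
  refine (orthDist_le_dist (ofNat n) b).trans_lt ?_
  rw [hb]
  exact_mod_cast Nat.lt_succ_self n

lemma isParent_of_orthDist_ne_top {a : I.ExtVertex} (ha : I.orthDist a ≠ ⊤) (hr : a ≠ .root) :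
    T.IsParent a (T.parent a) := ⟨parents_nonempty ha hr, rfl⟩

lemma isParent_rightUnique : Relator.RightUnique T.IsParent := by
  rintro a b c ⟨-, rfl⟩ ⟨-, rfl⟩
  rfl

lemma not_isParent_root {b : I.ExtVertex} : ¬ T.IsParent .root b := by
  rintro ⟨h, -⟩
  rw [parents_root] at h
  exact Set.not_nonempty_empty h

lemma mem_subtree_self (t : I.ExtVertex) : t ∈ T.subtree t := Relation.ReflTransGen.refl

lemma subtree_subset {s t : I.ExtVertex} (h : t ∈ T.subtree s) : T.subtree t ⊆ T.subtree s :=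
  fun _ ha => Relation.ReflTransGen.trans ha h

lemma IsParent.mem_subtree {a b t : I.ExtVertex} (h : T.IsParent a b) (hb : b ∈ T.subtree t) :
    a ∈ T.subtree t := Relation.ReflTransGen.head h hb

lemma mem_subtree_cases {a t : I.ExtVertex} (h : a ∈ T.subtree t) :
    a = t ∨ T.IsParent a (T.parent a) ∧ T.parent a ∈ T.subtree t := by
  rcases Relation.ReflTransGen.cases_head h with h | ⟨c, h1, h2⟩
  · exact Or.inl h
  · obtain rfl : T.parent a = c := h1.2
    exact Or.inr ⟨h1, h2⟩

lemma eq_or_orthDist_lt {a t : I.ExtVertex} (h : a ∈ T.subtree t) :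
    a = t ∨ I.orthDist t < I.orthDist a := by
  induction h using Relation.ReflTransGen.head_induction_on with
  | refl => exact Or.inl rfl
  | head h1 _ ih =>
    rcases ih with rfl | ih
    · exact Or.inr h1.orthDist_lt
    · exact Or.inr (ih.trans h1.orthDist_lt)

lemma orthDist_le_of_mem_subtree {a t : I.ExtVertex} (h : a ∈ T.subtree t) :
    I.orthDist t ≤ I.orthDist a := by
  rcases eq_or_orthDist_lt h with rfl | h
  · exact le_rfl
  · exact h.le

lemma subtree_antisymm {a t : I.ExtVertex} (h : a ∈ T.subtree t) (h' : t ∈ T.subtree a) :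
    a = t := by
  rcases eq_or_orthDist_lt h with h1 | h1
  · exact h1
  · exact absurd (orthDist_le_of_mem_subtree h') (not_le.2 h1)

lemma mem_subtree_total {a s t : I.ExtVertex} (hs : a ∈ T.subtree s) (ht : a ∈ T.subtree t) :
    s ∈ T.subtree t ∨ t ∈ T.subtree s :=
  Relation.ReflTransGen.total_of_right_unique isParent_rightUnique hs ht

lemma root_mem_subtree {t : I.ExtVertex} (h : .root ∈ T.subtree t) : t = .root := by
  rcases mem_subtree_cases h with h | h
  · exact h.symm
  · exact absurd h.1 not_isParent_root

lemma mem_subtree_root {a : I.ExtVertex} (ha : I.orthDist a ≠ ⊤) : a ∈ T.subtree .root := by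
  obtain ⟨n, hn⟩ := ENat.ne_top_iff_exists.1 ha
  induction n using Nat.strong_induction_on generalizing a with
  | _ n ih =>
    by_cases hr : a = .root
    · rw [hr]; exact mem_subtree_self _
    · have h1 := isParent_of_orthDist_ne_top (T := T) ha hr
      have h2 := h1.orthDist_lt
      obtain ⟨k, hk⟩ := ENat.ne_top_iff_exists.1 (ne_top_of_lt h2)
      rw [← hk, ← hn] at h2
      exact h1.mem_subtree (ih k (by exact_mod_cast h2) (ne_top_of_lt h1.orthDist_lt) hk)

/-- An edge that enters a subtree at a vertex other than its root is an incoming edge. -/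
lemma isIncoming_of {t y z : I.ExtVertex} (h : I.ext.Adj y z) (hz : z ∈ T.subtree t)
    (hy : y ∉ T.subtree t) (hp : ¬ T.IsParent z y) : T.IsIncoming t y z :=
  ⟨h, hz, hy, fun h' => hy (h'.mem_subtree hz), hp⟩

lemma eq_of_isParent {t y z : I.ExtVertex} (hz : z ∈ T.subtree t) (hy : y ∉ T.subtree t)
    (hp : T.IsParent z y) : z = t := by
  rcases mem_subtree_cases hz with h | ⟨h1, h2⟩
  · exact h
  · obtain rfl : T.parent z = y := hp.2
    exact absurd h2 hy

/-- A path inside a subtree can be appended to a shortest orthodox path to the root of the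
subtree. -/
lemma append_isPath {s v : I.ExtVertex} {A : I.ext.Walk .root s} {X : I.ext.Walk s v}
    (hA : A.IsPath) (hAa : A.Alternates I.extMatching.edgeSet 0)
    (hAl : I.orthDist s = A.length) (hX : X.IsPath)
    (hXa : X.Alternates I.extMatching.edgeSet A.length) (hXs : ∀ x ∈ X.support, x ∈ T.subtree s) :
    (A.append X).IsPath ∧ (A.append X).Alternates I.extMatching.edgeSet 0 := by
  rw [isPath_append_iff, alternates_append]
  refine ⟨⟨hA, hX, fun x h1 h2 => ?_⟩, hAa, by rwa [zero_add]⟩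
  -- Before s, a shortest path to s has only vertices of smaller orthodox distance, and the subtree
  -- of s has none of those.
  by_contra hne
  have h3 := orthDist_lt_of_mem hA hAa h1 hne
  have h4 := orthDist_le_of_mem_subtree (hXs x h2)
  rw [hAl] at h4
  exact absurd h4 (not_le.2 h3)

lemma reach_of_path {s v : I.ExtVertex} {k : ℕ} (hk : I.orthDist s = k) {X : I.ext.Walk s v}
    (hX : X.IsPath) (hXa : X.Alternates I.extMatching.edgeSet k)
    (hXs : ∀ x ∈ X.support, x ∈ T.subtree s) : I.Reach v (k + X.length) := by
  obtain ⟨⟨A, hA, hAa, rfl⟩, -⟩ := reach_of_orthDist_eq hk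
  obtain ⟨h1, h2⟩ := append_isPath hA hAa hk hX hXa hXs
  exact ⟨_, h1, h2, by simp⟩

lemma orthDist_le_of_mem_path {s v x : I.ExtVertex} {k : ℕ} (hk : I.orthDist s = k)
    {X : I.ext.Walk s v} (hX : X.IsPath) (hXa : X.Alternates I.extMatching.edgeSet k)
    (hXs : ∀ x ∈ X.support, x ∈ T.subtree s) (hx : x ∈ X.support) :
    I.orthDist x ≤ (k + X.length : ℕ) := by
  obtain ⟨⟨A, hA, hAa, rfl⟩, -⟩ := reach_of_orthDist_eq hk
  obtain ⟨h1, h2⟩ := append_isPath hA hAa hk hX hXa hXs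
  have := orthDist_le_of_mem h1 h2 (x := x) (by rw [mem_support_append_iff]; exact Or.inr hx)
  rwa [length_append] at this

/-- Cut a shortest θ-path to t at its last entry {y, z} into the subtree. The prefix reaches y; the
rest, reversed and appended to a shortest orthodox path to t, reaches z with the parity ρ. The two
lengths plus 1 make up the tenacity of t. -/
lemma exists_incoming {t : I.ExtVertex} {θ : PathParity} {n : ℕ} (hθ : ¬ I.IsOrthodox θ t)
    (hn : I.dist θ t = n) :
    ∃ y z, T.IsIncoming t y z ∧ I.volume y z ≤ I.tenacity t ∧ I.height y z < n := by
  obtain ⟨k, hk, hkθ, hkn, hten⟩ := exists_unorthodox_dist hθ hn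
  obtain ⟨⟨P, hP, hPa, hPl⟩, hnθ⟩ := reach_of_dist_eq hn
  have hr : ExtVertex.root ∉ T.subtree t := fun h => by
    rw [root_mem_subtree h, tenacity_root] at hten
    exact ENat.top_ne_natCast _ hten
  obtain ⟨y, z, q, h, r, rfl, hy, hrs⟩ := exists_last_entry _ P hr (mem_subtree_self t)
  have hz : z ∈ T.subtree t := hrs z r.start_mem_support
  obtain ⟨hqa, hE, hra⟩ := (alternates_append _ _).1 hPa
  rw [zero_add] at hE hra
  rw [length_append, length_cons] at hPl
  have hpar : (n + 1) % 2 = k % 2 := by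
    rw [← ofNat_eq_ofNat, ← PathParity.flip_ofNat, ← hnθ, hkθ]
  have hrho := rho_eq_ofNat.2 hE
  have hreachy : I.Reach y q.length := reach_of_append hP hPa
  have hrev : r.reverse.Alternates I.extMatching.edgeSet k := hra.reverse (by omega)
  have hrpath : r.IsPath := (hP.of_append_right).of_cons
  have hreachz := reach_of_path hk hrpath.reverse hrev (T := T) (by simpa using hrs)
  rw [length_reverse] at hreachz
  have hreachz' : I.Reach z (q.length + 1) := by
    rw [← concat_append] at hP hPa
    simpa using reach_of_append hP hPa
  have hy1 := hreachy.dist_le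
  have hz1 := hreachz.dist_le
  have hpar2 : (k + r.length) % 2 = q.length % 2 := by omega
  rw [ofNat_eq_ofNat.2 hpar2] at hz1
  refine ⟨y, z, isIncoming_of h hz hy fun hp => ?_, ?_, ?_⟩
  -- The tree edge into t would be the last edge of the path, whose length would then have the
  -- orthodox parity.
  · obtain rfl := eq_of_isParent hz hy hp
    rw [isPath_iff_nil, ← eq_nil_iff_nil] at hrpath
    subst hrpath
    obtain ⟨k', -, hr', -, ho⟩ := mem_parents_iff.1 hp.mem_parents
    rw [hk] at ho
    have ho : k = k' + 1 := by exact_mod_cast ho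
    have := ofNat_eq_ofNat.1 (hrho.symm.trans hr')
    rw [length_nil] at hPl
    omega
  · unfold volume
    rw [hrho, hten, ← hPl]
    refine (add_le_add_left (add_le_add hy1 hz1) 1).trans ?_
    exact_mod_cast (by omega)
  · unfold height
    rw [hrho]
    refine max_lt (hy1.trans_lt (by exact_mod_cast (by omega))) (hz1.trans_lt ?_)
    -- For z ≠ t, the orthodox distance of z exceeds k but is at most that of the prefix ending at
    -- z.
    have : k + r.length < n := by
      rcases eq_or_orthDist_lt hz with rfl | hlt
      · rw [isPath_iff_nil, ← eq_nil_iff_nil] at hrpath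
        subst hrpath
        simpa using hkn
      · have := hlt.trans_le hreachz'.orthDist_le
        rw [hk] at this
        have : k < q.length + 1 := by exact_mod_cast this
        omega
    exact_mod_cast this

variable {m : I.ExtVertex → I.ExtVertex × I.ExtVertex}

lemma IsMIE.level_le {t y z y' z' : I.ExtVertex} (h : T.IsMIE t y z) (h' : T.IsIncoming t y' z') :
    I.level y z ≤ I.level y' z' := by
  rw [level, level, Prod.Lex.toLex_le_toLex]
  exact h.2 y' z' h'

lemma IsMIEChoice.of_unorthodox (hm : T.IsMIEChoice m) {t : I.ExtVertex} {θ : PathParity} {n : ℕ}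
    (hθ : ¬ I.IsOrthodox θ t) (hn : I.dist θ t = n) :
    T.IsMIE t (m t).1 (m t).2 ∧ I.volume (m t).1 (m t).2 ≤ I.tenacity t ∧
      I.level (m t).1 (m t).2 < toLex (I.tenacity t, (n : ℕ∞)) := by
  obtain ⟨y, z, h1, h2, h3⟩ := exists_incoming (T := T) hθ hn
  have h4 := hm t ⟨y, z, h1⟩
  have h5 : I.level (m t).1 (m t).2 < toLex (I.tenacity t, (n : ℕ∞)) := by
    refine (h4.level_le h1).trans_lt ?_
    rw [level, Prod.Lex.toLex_lt_toLex]
    rcases h2.lt_or_eq with h | h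
    · exact Or.inl h
    · exact Or.inr ⟨h, h3⟩
  refine ⟨h4, ?_, h5⟩
  rw [level, Prod.Lex.toLex_lt_toLex] at h5
  rcases h5 with h | h
  · exact h.le
  · exact h.1.le

/-- The recursion of PathConstruction from the vertex `v` with parity `θ` uses minimum incoming
edges of level less than `L` only. -/
def LevelBound (m : I.ExtVertex → I.ExtVertex × I.ExtVertex) (L : ℕ∞ ×ₗ ℕ∞) (v : I.ExtVertex)
    (θ : PathParity) : Prop :=
  (¬ I.IsOrthodox θ v → I.level (m v).1 (m v).2 < L) ∧
    (I.IsOrthodox θ v → 2 * I.dist θ v ≤ (ofLex L).1)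

lemma lt_of_fst_lt {a : ℕ∞ × ℕ∞} {L : ℕ∞ ×ₗ ℕ∞} (h : a.1 < (ofLex L).1) : toLex a < L := by
  rw [Prod.Lex.lt_iff]
  exact Or.inl h

/-- With orthDist v = n + 1, an unorthodox parity at the parent means tenacity below 2n there, which
is less than 2(n + 1). This is what the factor 2 in `LevelBound` is for. -/
lemma LevelBound.parent (hm : T.IsMIEChoice m) {L : ℕ∞ ×ₗ ℕ∞} {v p : I.ExtVertex} {θ : PathParity}
    (h : LevelBound m L v θ) (hθ : I.IsOrthodox θ v) (hp : p ∈ I.parents v) :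
    LevelBound m L p θ.flip := by
  obtain ⟨n, -, -, hd, ho⟩ := mem_parents_iff.1 hp
  have h1 := h.2 hθ
  have h2 := hθ.dist_eq
  rw [h2, ho] at h1
  rw [ho] at h2
  have h3 : θ.flip = ofNat n := by
    rw [(reach_of_dist_eq h2).2, PathParity.flip_ofNat, ofNat_eq_ofNat]; omega
  rw [h3]
  constructor
  · intro h4
    refine (hm.of_unorthodox h4 hd).2.2.trans (lt_of_fst_lt (lt_of_lt_of_le ?_ h1))
    obtain ⟨k, -, -, hkn, hten⟩ := exists_unorthodox_dist h4 hd
    simp only [hten]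
    exact_mod_cast (by omega)
  · intro _
    rw [hd]
    refine le_trans ?_ h1
    exact_mod_cast (by omega)

/-- A path to y of parity ρ either extends over the edge to z with the unorthodox parity or already
contains z. Both make the orthodox distance of z at most the ρ-distance of y. -/
lemma two_mul_dist_le_volume {y z : I.ExtVertex} (h : I.ext.Adj y z)
    (hz : I.IsOrthodox (I.rho y z) z) :
    2 * I.dist (I.rho y z) z ≤ I.volume y z := by
  by_cases hv : I.volume y z = ⊤
  · rw [hv]; exact le_top
  obtain ⟨a, c, ha, hc, hya, hzc, hra, hrc, hvol⟩ := exists_dist_of_volume_ne_top hv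
  rw [hvol, hc]
  have hca : c ≤ a := by
    have h1 := hz.dist_eq
    rw [hc] at h1
    rcases hya.extend h hra with h2 | h2
    · rw [← h1] at h2; exact_mod_cast h2
    · have h3 := h2.dist_le
      rw [← PathParity.flip_ofNat, ← hra] at h3
      have h4 := lt_of_lt_of_le hz h3
      rw [hc] at h4
      have : c < a + 1 := by exact_mod_cast h4
      omega
  exact_mod_cast (by omega)

/-- The orthodox distance of z is at most one more than the ρ-distance of y; equality would make y a
parent of z, which gives the strict version below. -/
lemma tenacity_le_volume {y z : I.ExtVertex} (h : I.ext.Adj y z)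
    (hz : ¬ I.IsOrthodox (I.rho y z) z) : I.tenacity z ≤ I.volume y z := by
  by_cases hv : I.volume y z = ⊤
  · rw [hv]; exact le_top
  obtain ⟨a, c, ha, hc, hya, hzc, hra, hrc, hvol⟩ := exists_dist_of_volume_ne_top hv
  obtain ⟨k, hk, -, -, hten⟩ := exists_unorthodox_dist hz hc
  have h1 := hya.orthDist_le_succ h hra
  rw [hk] at h1
  have : k ≤ a + 1 := by exact_mod_cast h1
  rw [hten, hvol]
  exact_mod_cast (by omega)

lemma tenacity_lt_volume {y z : I.ExtVertex} (h : I.ext.Adj y z)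
    (hz : ¬ I.IsOrthodox (I.rho y z) z) (hv : I.volume y z ≠ ⊤) (hy : y ∉ I.parents z) :
    I.tenacity z < I.volume y z := by
  obtain ⟨a, c, ha, hc, hya, hzc, hra, hrc, hvol⟩ := exists_dist_of_volume_ne_top hv
  obtain ⟨k, hk, -, -, hten⟩ := exists_unorthodox_dist hz hc
  have h1 : ¬ (a + 1 : ℕ) ≤ I.orthDist z := fun h1 => hy (mem_parents_of_reach hya h hra h1)
  rw [hk] at h1
  have : ¬ a + 1 ≤ k := by exact_mod_cast h1
  rw [hten, hvol]
  exact_mod_cast (by omega)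

/-- If y is a possible parent of z, volumes can tie. The height breaks the tie: the MIE at z is
lexicographically below (tenacity of z, ρ-distance of z). -/
lemma levelBound_of_edge (hm : T.IsMIEChoice m) {y z : I.ExtVertex} (h : I.ext.Adj y z)
    (hv : I.volume y z ≠ ⊤) : LevelBound m (I.level y z) z (I.rho y z) := by
  refine ⟨fun h1 => ?_, two_mul_dist_le_volume h⟩
  obtain ⟨a, c, ha, hc, -⟩ := exists_dist_of_volume_ne_top hv
  refine (hm.of_unorthodox h1 hc).2.2.trans_le ?_
  rw [level, Prod.Lex.toLex_le_toLex]
  rcases (tenacity_le_volume h h1).lt_or_eq with h2 | h2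
  · exact Or.inl h2
  · refine Or.inr ⟨h2, ?_⟩
    rw [height, hc]
    exact le_max_right _ _

/-- For a critical edge the volume drops strictly, so height 0 suffices in the bound; this is the
bound available at subtrees of free vertices. -/
lemma levelBound_of_critical (hm : T.IsMIEChoice m) {y z : I.ExtVertex} (h : I.ext.Adj y z)
    (hv : I.volume y z ≠ ⊤) (hy : y ∉ I.parents z) :
    LevelBound m (toLex (I.volume y z, 0)) z (I.rho y z) := by
  refine ⟨fun h1 => ?_, two_mul_dist_le_volume h⟩
  obtain ⟨a, c, ha, hc, -⟩ := exists_dist_of_volume_ne_top hv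
  exact lt_of_fst_lt ((hm.of_unorthodox h1 hc).2.1.trans_lt (tenacity_lt_volume h h1 hv hy))

end ABT

end MatchingSystem

/-! ### Correctness of PathConstruction. -/

namespace MatchingSystem.ABT

open PathParity (ofNat ofNat_eq_ofNat)
open SimpleGraph SimpleGraph.Walk

variable {V : Type*} {I : MatchingSystem V} {T : I.ABT}
  {m : I.ExtVertex → I.ExtVertex × I.ExtVertex}

/-- Every incoming edge of the subtree rooted at `t` has level at least `L`. -/
def LevelGE (T : I.ABT) (L : ℕ∞ ×ₗ ℕ∞) (t : I.ExtVertex) : Prop :=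
  ∀ y z, T.IsIncoming t y z → L ≤ I.level y z

lemma LevelGE.mono {L L' : ℕ∞ ×ₗ ℕ∞} {t : I.ExtVertex} (h : T.LevelGE L t) (hL : L' ≤ L) :
    T.LevelGE L' t := fun y z hyz => hL.trans (h y z hyz)

/-- A non-tree edge with just one end in the subtree of t would be incoming there. Being incoming at
w only serves to exclude tree edges. -/
lemma LevelGE.mem_iff {L : ℕ∞ ×ₗ ℕ∞} {t w y z : I.ExtVertex} (h : T.LevelGE L t)
    (hyz : T.IsIncoming w y z) (hl : I.level y z < L) : y ∈ T.subtree t ↔ z ∈ T.subtree t := by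
  obtain ⟨ha, -, -, h1, h2⟩ := hyz
  by_contra hne
  by_cases hz : z ∈ T.subtree t
  · have hy : y ∉ T.subtree t := fun hy => hne ⟨fun _ => hz, fun _ => hy⟩
    exact absurd hl (not_lt.2 (h y z ⟨ha, hz, hy, h1, h2⟩))
  · have hy : y ∈ T.subtree t := by
      by_contra hy; exact hne ⟨fun h => absurd h hy, fun h => absurd h hz⟩
    rw [level_comm] at hl
    exact absurd hl (not_lt.2 (h z y ⟨ha.symm, hy, hz, h2, h1⟩))

/-- The tree contains every reached vertex, so an incoming edge has an unreached end and infinite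
volume. -/
lemma levelGE_root {L : ℕ∞ ×ₗ ℕ∞} (hL : (ofLex L).1 ≠ ⊤) : T.LevelGE L .root := by
  intro y z h
  have hy : I.volume y z = ⊤ := by
    by_contra hv
    obtain ⟨a, c, ha, -, hr, -⟩ := exists_dist_of_volume_ne_top hv
    exact h.2.2.1 (mem_subtree_root (ne_top_of_le_ne_top (by simp) hr.orthDist_le))
  refine le_of_lt ?_
  rw [Prod.Lex.lt_iff]
  left
  rw [level, ofLex_toLex, hy]
  exact lt_top_iff_ne_top.2 hL

lemma append_cons_reverse {s t y z : I.ExtVertex} {k k' : ℕ}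
    (h : I.ext.Adj y z) {Y : I.ext.Walk s y} {Z : I.ext.Walk t z}
    (hY : Y.IsPath) (hYa : Y.Alternates I.extMatching.edgeSet k)
    (hYs : ∀ x ∈ Y.support, x ∈ T.subtree s) (hYt : ∀ x ∈ Y.support, x ∉ T.subtree t)
    (hZ : Z.IsPath) (hZa : Z.Alternates I.extMatching.edgeSet k')
    (hZt : ∀ x ∈ Z.support, x ∈ T.subtree t)
    (hry : I.rho y z = ofNat (k + Y.length)) (hrz : I.rho y z = ofNat (k' + Z.length)) :
    (Y.append (.cons h Z.reverse)).IsPath ∧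
      (Y.append (.cons h Z.reverse)).Alternates I.extMatching.edgeSet k ∧
      ∀ x ∈ (Y.append (.cons h Z.reverse)).support,
        x ∈ T.subtree s ∨ x ∈ T.subtree t := by
  have hy : y ∉ T.subtree t := hYt y Y.end_mem_support
  have hpar := ofNat_eq_ofNat.1 (hry.symm.trans hrz)
  refine ⟨?_, ?_, ?_⟩
  · rw [isPath_append_iff, cons_isPath_iff]
    refine ⟨hY, ⟨hZ.reverse, fun hm => ?_⟩, fun x h1 h2 => ?_⟩
    · rw [support_reverse, List.mem_reverse] at hm
      exact hy (hZt y hm)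
    · rw [support_cons, List.mem_cons, support_reverse, List.mem_reverse] at h2
      rcases h2 with h2 | h2
      · exact h2
      · exact absurd (hZt x h2) (hYt x h1)
  · rw [alternates_append, alternates_cons]
    exact ⟨hYa, rho_eq_ofNat.1 hry, hZa.reverse (by omega)⟩
  · intro x hx
    rw [mem_support_append_iff, support_cons, List.mem_cons, support_reverse,
      List.mem_reverse] at hx
    rcases hx with hx | rfl | hx
    · exact Or.inl (hYs x hx)
    · exact Or.inl (hYs x Y.end_mem_support)
    · exact Or.inr (hZt x hx)

/-- The procedure PathConstruction returns a path within the subtree rooted at `s`, that extends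
each shortest orthodox path to `s` to a shortest path of parity `θ` to `v`, and respects the subtrees
all of whose incoming edges have level at least `L`. -/
theorem exists_pathConstruction (hm : T.IsMIEChoice m) (L : ℕ∞ ×ₗ ℕ∞) :
    ∀ (n : ℕ) (s v : I.ExtVertex) (θ : PathParity) (k : ℕ), I.orthDist s = k → T.LevelGE L s →
      v ∈ T.subtree s → I.dist θ v = n → LevelBound m L v θ →
      ∃ X : I.ext.Walk s v, T.PathConstruction m s v θ X ∧ X.IsPath ∧
        X.Alternates I.extMatching.edgeSet k ∧ (∀ x ∈ X.support, x ∈ T.subtree s) ∧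
        k + X.length = n ∧
        (∀ t, T.LevelGE L t → v ∉ T.subtree t → ∀ x ∈ X.support, x ∉ T.subtree t) ∧
        ∀ b, T.LevelGE L b → v ∈ T.subtree b → b ∈ T.subtree s → b ∈ X.support := by
  -- An unorthodox call lowers L to the level of its MIE; an orthodox call keeps L and lowers n.
  induction L using WellFoundedLT.induction with
  | _ L ihL =>
  intro n
  induction n using Nat.strong_induction_on with
  | _ n ih =>
  intro s v θ k hk hs hvs hn hb
  by_cases hθ : I.IsOrthodox θ v
  · by_cases hsv : s = v
    · subst hsv
      refine ⟨.nil, .base s θ, by simp, by simp, ?_, ?_, ?_, ?_⟩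
      · simpa using hvs
      · rw [hθ.dist_eq, hk] at hn
        have : k = n := by exact_mod_cast hn
        simpa using this
      · intro t _ ht x hx
        rw [support_nil, List.mem_singleton] at hx
        rwa [hx]
      · intro b _ h1 h2
        rw [subtree_antisymm h2 h1]
        simp
    · obtain ⟨hp, hps⟩ := (mem_subtree_cases hvs).resolve_left (Ne.symm hsv)
      have hpm := hp.mem_parents
      obtain ⟨n', hadj, hrho, hd, ho⟩ := mem_parents_iff.1 hpm
      have hn' : n = n' + 1 := by
        rw [hθ.dist_eq, ho] at hn; exact_mod_cast hn.symm
      have hflip : θ.flip = ofNat n' := by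
        rw [(reach_of_dist_eq hn).2, PathParity.flip_ofNat, ofNat_eq_ofNat]; omega
      obtain ⟨X, hX1, hX2, hX3, hX4, hX5, hX6, hX7⟩ :=
        ih n' (by omega) s (T.parent v) θ.flip k hk hs hps (by rw [hflip, hd])
          (hb.parent hm hθ hpm)
      refine ⟨X.concat hadj, .orthodox s v θ X hsv hθ hadj hX1, hX2.concat ?_ hadj, ?_, ?_, ?_,
        ?_, ?_⟩
      · intro hv
        have := orthDist_le_of_mem_path hk hX2 hX3 hX4 hv
        rw [ho, hX5] at this
        have : n' + 1 ≤ n' := by exact_mod_cast this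
        omega
      · rw [alternates_concat, hX5]
        exact ⟨hX3, rho_eq_ofNat.1 hrho⟩
      · intro x hx
        rw [support_concat, List.mem_append, List.mem_singleton] at hx
        rcases hx with hx | rfl
        · exact hX4 x hx
        · exact hvs
      · rw [length_concat]; omega
      · intro t ht hvt x hx
        rw [support_concat, List.mem_append, List.mem_singleton] at hx
        rcases hx with hx | rfl
        · exact hX6 t ht (fun h => hvt (hp.mem_subtree h)) x hx
        · exact hvt
      · intro b hbL hvb hbs
        rw [support_concat, List.mem_append, List.mem_singleton]
        rcases mem_subtree_cases hvb with h | h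
        · exact Or.inr h.symm
        · exact Or.inl (hX7 b hbL h.2 hbs)
  · obtain ⟨hmie, hvol, -⟩ := hm.of_unorthodox hθ hn
    obtain ⟨k', hk', hkθ, -, hten⟩ := exists_unorthodox_dist hθ hn
    have hlev := hb.1 hθ
    obtain ⟨y, z, hyz⟩ : ∃ y z, m v = (y, z) := ⟨_, _, rfl⟩
    rw [hyz] at hmie hvol hlev
    dsimp only at hmie hvol hlev
    have hinc := hmie.1
    have hvtop : I.volume y z ≠ ⊤ := ne_top_of_le_ne_top (by rw [hten]; simp) hvol
    -- Otherwise the MIE of the subtree of s would have level below L. So the base rule never fires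
    -- with the wrong parity.
    have hsv : s ≠ v := by
      rintro rfl
      exact absurd hlev (not_lt.2 (hs y z hinc))
    have hzs : z ∈ T.subtree s := subtree_subset hvs hinc.2.1
    have hys : y ∈ T.subtree s := (hs.mem_iff hinc hlev).2 hzs
    obtain ⟨a, c, ha, hc, -, -, hra, hrc, hvac⟩ := exists_dist_of_volume_ne_top hvtop
    -- By minimality of the MIE, the subtree of v is closed at its level. So the second call applies
    -- below v, and the first avoids this subtree.
    have hv' : T.LevelGE (I.level y z) v := fun y' z' h => hmie.level_le h
    obtain ⟨Y, hY1, hY2, hY3, hY4, hY5, hY6, hY7⟩ :=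
      ihL _ hlev a s y (I.rho y z) k hk (hs.mono hlev.le) hys ha (by
        have := levelBound_of_edge hm hinc.1.symm (by rwa [volume_comm])
        rwa [level_comm, rho_comm] at this)
    obtain ⟨Z, hZ1, hZ2, hZ3, hZ4, hZ5, hZ6, hZ7⟩ :=
      ihL _ hlev c v z (I.rho y z) k' hk' hv' hinc.2.1 hc (levelBound_of_edge hm hinc.1 hvtop)
    obtain ⟨h1, h2, h3⟩ := append_cons_reverse hinc.1 hY2 hY3 hY4 (hY6 v hv' hinc.2.2.1)
      hZ2 hZ3 hZ4 (by rw [hY5, hra]) (by rw [hZ5, hrc])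
    replace h3 := fun x hx => (h3 x hx).elim id fun h => subtree_subset hvs h
    have hacle : a + c + 1 ≤ n + k' := by
      rw [hvac, hten] at hvol; exact_mod_cast hvol
    have hlen : (Y.append (.cons hinc.1 Z.reverse)).length = Y.length + Z.length + 1 := by
      simp only [length_append, length_cons, length_reverse]; omega
    -- The new path has parity θ, so it is no shorter than n; `hacle` (volume at most tenacity)
    -- gives the reverse inequality.
    have hle : n ≤ k + (Y.length + Z.length + 1) := by
      have h4 := (reach_of_path hk h1 h2 h3).dist_le
      rw [hlen] at h4
      have hpar := ofNat_eq_ofNat.1 (hra.symm.trans hrc)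
      have hpar' : (n + 1) % 2 = k' % 2 := by
        rw [← ofNat_eq_ofNat, ← PathParity.flip_ofNat, ← (reach_of_dist_eq hn).2, hkθ]
      rw [ofNat_eq_ofNat.2 (show (k + (Y.length + Z.length + 1)) % 2 = n % 2 by omega),
        ← (reach_of_dist_eq hn).2, hn] at h4
      exact_mod_cast h4
    refine ⟨Y.append (.cons hinc.1 Z.reverse),
      .unorthodox s v y z θ Y Z hsv hθ hyz hinc.1 hY1 hZ1, h1, h2, h3, by omega, ?_, ?_⟩
    · intro t ht hvt x hx
      have hiff := ht.mem_iff hinc hlev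
      -- If z were below t, so would y be. Then t lies below v, putting y below v as well, or v lies
      -- below t; both are excluded.
      have hzt : z ∉ T.subtree t := fun hzt => by
        rcases mem_subtree_total hzt hinc.2.1 with h | h
        · exact hinc.2.2.1 (subtree_subset h (hiff.2 hzt))
        · exact hvt h
      rw [mem_support_append_iff, support_cons, List.mem_cons, support_reverse,
        List.mem_reverse] at hx
      have hyt : y ∉ T.subtree t := fun h => hzt (hiff.1 h)
      rcases hx with hx | rfl | hx
      · exact hY6 t (ht.mono hlev.le) hyt x hx
      · exact hyt
      · exact hZ6 t (ht.mono hlev.le) hzt x hx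
    -- The MIE cannot cross into the subtree of b, so y is below b and the first half already passes
    -- through b.
    · intro b hbL hvb hbs
      have hyb : y ∈ T.subtree b :=
        (hbL.mem_iff hinc hlev).2 (subtree_subset hvb hinc.2.1)
      rw [mem_support_append_iff]
      exact Or.inl (hY7 b (hbL.mono hlev.le) hyb hbs)

lemma exists_isMIEChoice (T : I.ABT) : ∃ m, T.IsMIEChoice m := by
  classical
  have key : ∀ t, ∃ e : I.ExtVertex × I.ExtVertex, (∃ y z, T.IsIncoming t y z) →
      T.IsMIE t e.1 e.2 := by
    intro t
    by_cases h : ∃ y z, T.IsIncoming t y z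
    · obtain ⟨y, z, hyz⟩ := h
      obtain ⟨e, he, hmin⟩ := WellFounded.has_min
        (InvImage.wf (fun e : I.ExtVertex × I.ExtVertex => I.level e.1 e.2) wellFounded_lt)
        {e | T.IsIncoming t e.1 e.2} ⟨(y, z), hyz⟩
      refine ⟨e, fun _ => ⟨he, fun y' z' h' => ?_⟩⟩
      have : I.level e.1 e.2 ≤ I.level y' z' := not_lt.1 (hmin (y', z') h')
      rwa [level, level, Prod.Lex.toLex_le_toLex] at this
    · exact ⟨(t, t), fun h' => absurd h' h⟩
  choose m hm using key
  exact ⟨m, hm⟩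

/-- An incoming edge of a subtree has volume at least the tenacity of the root of the subtree. -/
theorem tenacity_le_of_isIncoming {t y z : I.ExtVertex} (ht : I.orthDist t ≠ ⊤)
    (h : T.IsIncoming t y z) : I.tenacity t ≤ I.volume y z := by
  obtain ⟨m, hm⟩ := exists_isMIEChoice T
  have hmie := hm t ⟨y, z, h⟩
  have hle : I.volume (m t).1 (m t).2 ≤ I.volume y z := by
    rcases hmie.2 y z h with h1 | h1
    · exact h1.le
    · exact h1.1.le
  -- For the MIE the subtree of t is closed at the level in question, so the root-to-y path and the
  -- t-to-z path are disjoint. Joining them reaches t with the unorthodox parity, and the length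
  -- plus orthDist t is the volume.
  refine le_trans ?_ hle
  generalize (m t).1 = y at *
  generalize (m t).2 = z at *
  by_cases hv : I.volume y z = ⊤
  · rw [hv]; exact le_top
  obtain ⟨k, hk⟩ := ENat.ne_top_iff_exists.1 ht
  obtain ⟨a, c, ha, hc, hya, -, hra, hrc, hvac⟩ := exists_dist_of_volume_ne_top hv
  have hinc := hmie.1
  have hL : T.LevelGE (I.level y z) t := fun y' z' h => hmie.level_le h
  have htr : t ∈ T.subtree .root := mem_subtree_root ht
  have h0 : I.orthDist (.root : I.ExtVertex) = (0 : ℕ) :=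
    le_antisymm reach_root.orthDist_le (by simp)
  obtain ⟨Y, hY1, hY2, hY3, hY4, hY5, hY6, hY7⟩ :=
    exists_pathConstruction hm (I.level y z) a .root y (I.rho y z) 0 h0
      (levelGE_root (by exact hv))
      (mem_subtree_root (ne_top_of_le_ne_top (by simp) hya.orthDist_le)) ha (by
      have := levelBound_of_edge hm hinc.1.symm (by rwa [volume_comm])
      rwa [level_comm, rho_comm] at this)
  obtain ⟨Z, hZ1, hZ2, hZ3, hZ4, hZ5, hZ6, hZ7⟩ :=
    exists_pathConstruction hm (I.level y z) c t z (I.rho y z) k hk.symm hL hinc.2.1 hc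
      (levelBound_of_edge hm hinc.1 hv)
  obtain ⟨h1, h2, h3⟩ := append_cons_reverse hinc.1 hY2 hY3 hY4 (hY6 t hL hinc.2.2.1)
    hZ2 hZ3 hZ4 (by rw [hY5, hra]) (by rw [hZ5, hrc])
  replace h3 := fun x hx => (h3 x hx).elim id fun h => subtree_subset htr h
  have h4 := (reach_of_path h0 h1 h2 h3).dist_le
  have hlen : (Y.append (.cons hinc.1 Z.reverse)).length = Y.length + Z.length + 1 := by
    simp only [length_append, length_cons, length_reverse]; omega
  have hpar := ofNat_eq_ofNat.1 (hra.symm.trans hrc)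
  rw [hlen, ofNat_eq_ofNat.2 (show (0 + (Y.length + Z.length + 1)) % 2 = (k + 1) % 2 by omega),
    ← PathParity.flip_ofNat] at h4
  rw [tenacity_eq (ofNat k), (reach_of_orthDist_eq hk.symm).2, hvac]
  refine (add_le_add le_rfl h4).trans ?_
  exact_mod_cast (by omega)

end MatchingSystem.ABT

/-! ### Bags, and how shortest augmenting paths traverse them. -/

namespace MatchingSystem

open PathParity (ofNat ofNat_eq_ofNat)
open SimpleGraph SimpleGraph.Walk

variable {V : Type*} {I : MatchingSystem V} {T : I.ABT}

namespace ABT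

/-- The vertices from which `b` is the first vertex of tenacity at least `K` on the way to the root
of the tree, provided that `b` has tenacity at least `K`. -/
def bag (T : I.ABT) (K : ℕ∞) (b : I.ExtVertex) : Set I.ExtVertex :=
  {x | Relation.ReflTransGen (fun a c => T.IsParent a c ∧ I.tenacity a < K) x b}

variable {K : ℕ∞}

lemma bag_subset_subtree (b : I.ExtVertex) : T.bag K b ⊆ T.subtree b :=
  fun _ hx => Relation.ReflTransGen.mono (fun _ _ h => h.1) _ _ hx

lemma mem_bag_cases {a b : I.ExtVertex} (h : a ∈ T.bag K b) :
    a = b ∨ T.IsParent a (T.parent a) ∧ I.tenacity a < K ∧ T.parent a ∈ T.bag K b := by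
  rcases Relation.ReflTransGen.cases_head h with h | ⟨c, h1, h2⟩
  · exact Or.inl h
  · obtain rfl : T.parent a = c := h1.1.2
    exact Or.inr ⟨h1.1, h1.2, h2⟩

lemma exists_mem_bag {a : I.ExtVertex} (ha : I.orthDist a ≠ ⊤) :
    ∃ b, a ∈ T.bag K b ∧ K ≤ I.tenacity b := by
  obtain ⟨n, hn⟩ := ENat.ne_top_iff_exists.1 ha
  induction n using Nat.strong_induction_on generalizing a with
  | _ n ih =>
    by_cases hK : K ≤ I.tenacity a
    · exact ⟨a, Relation.ReflTransGen.refl, hK⟩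
    · have hr : a ≠ .root := by
        rintro rfl
        rw [tenacity_root] at hK
        exact hK le_top
      have h1 := isParent_of_orthDist_ne_top (T := T) ha hr
      have h2 := h1.orthDist_lt
      have h3 := ne_top_of_lt h2
      obtain ⟨k, hk⟩ := ENat.ne_top_iff_exists.1 h3
      rw [← hk, ← hn] at h2
      obtain ⟨b, hb, hKb⟩ := ih k (by exact_mod_cast h2) h3 hk
      exact ⟨b, Relation.ReflTransGen.head ⟨h1, not_le.1 hK⟩ hb, hKb⟩

/-- All vertices before b' on the tree path from a have tenacity below K, so b cannot come before
b'. -/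
lemma mem_subtree_of_mem_bag {a b b' : I.ExtVertex} (h' : a ∈ T.bag K b') (h : a ∈ T.subtree b)
    (hb : K ≤ I.tenacity b) : b' ∈ T.subtree b := by
  induction h' using Relation.ReflTransGen.head_induction_on with
  | refl => exact h
  | head h1 _ ih =>
    rcases mem_subtree_cases h with rfl | ⟨-, h2⟩
    · exact absurd hb (not_le.2 h1.2)
    · rw [h1.1.2] at h2
      exact ih h2

/-- An edge that leaves a bag has large volume. -/
lemma le_volume_of_bag {b y z : I.ExtVertex} (hb : K ≤ I.tenacity b) (h : I.ext.Adj y z)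
    (hz : z ∈ T.bag K b) (hy : y ∉ T.bag K b) : K ≤ I.volume y z := by
  by_cases hv : I.volume y z = ⊤
  · rw [hv]; exact le_top
  obtain ⟨a, c, -, -, hya, hzc, -⟩ := exists_dist_of_volume_ne_top hv
  have hytop : I.orthDist y ≠ ⊤ := ne_top_of_le_ne_top (by simp) hya.orthDist_le
  have hztop : I.orthDist z ≠ ⊤ := ne_top_of_le_ne_top (by simp) hzc.orthDist_le
  by_cases hp : T.IsParent z y
  · rw [volume_of_mem_parents hp.mem_parents]
    rcases mem_bag_cases hz with rfl | ⟨-, -, h2⟩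
    · exact hb
    · rw [hp.2] at h2
      exact absurd h2 hy
  by_cases hp' : T.IsParent y z
  · rw [volume_comm, volume_of_mem_parents hp'.mem_parents]
    by_contra hK
    exact hy (Relation.ReflTransGen.head ⟨hp', not_le.1 hK⟩ hz)
  -- The edge is not a tree edge. Either it is incoming at b or at the base b' of y, or b and b' lie
  -- below each other and coincide.
  obtain ⟨b', hyb', hb'⟩ := exists_mem_bag (T := T) (K := K) hytop
  by_cases h1 : y ∈ T.subtree b
  · by_cases h2 : z ∈ T.subtree b'
    · have := subtree_antisymm (mem_subtree_of_mem_bag hz h2 hb')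
        (mem_subtree_of_mem_bag hyb' h1 hb)
      rw [this] at hy
      exact absurd hyb' hy
    · rw [volume_comm]
      exact hb'.trans (tenacity_le_of_isIncoming (T := T)
        (ne_top_of_le_ne_top hytop (orthDist_le_of_mem_subtree (bag_subset_subtree _ hyb')))
        ⟨h.symm, bag_subset_subtree _ hyb', h2, hp, hp'⟩)
  · exact hb.trans (tenacity_le_of_isIncoming (T := T)
      (ne_top_of_le_ne_top hztop (orthDist_le_of_mem_subtree (bag_subset_subtree _ hz)))
      ⟨h, bag_subset_subtree _ hz, h1, hp', hp⟩)

end ABT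

/-- If a path from `z₁` to `z₂` can only be reached at its ends by detours through the other end, up
to one shorter way to `z₁` of the other parity, then the way to the first end is the longer one. -/
lemma lt_of_segment {z₁ z₂ : I.ExtVertex} {l r : ℕ} {p : I.ext.Walk z₁ z₂} (hp : p.IsPath)
    (ha : p.Alternates I.extMatching.edgeSet (l + 1)) (hodd : (l + r + p.length) % 2 = 1)
    (h₁ : (p.length + r + 1 : ℕ) ≤ I.dist (ofNat l) z₁)
    (h₂ : (p.length + l + 1 : ℕ) ≤ I.dist (ofNat r) z₂)
    (h₃ : I.dist (ofNat (l + 1)) z₁ < (l + 1 : ℕ)) : r < l := by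
  obtain ⟨n, hn⟩ := ENat.ne_top_iff_exists.1 (ne_top_of_lt h₃)
  rw [← hn] at h₃
  have hnl : n < l + 1 := by exact_mod_cast h₃
  obtain ⟨⟨A, hA, hAa, hAl⟩, hpar⟩ := reach_of_dist_eq hn.symm
  rw [ofNat_eq_ofNat] at hpar
  obtain ⟨w, A₁, A₂, rfl, hw, hfirst⟩ :=
    exists_first_mem {x | x ∈ p.support} A p.start_mem_support
  obtain ⟨g₁, g₂, rfl⟩ := mem_support_iff_exists_append.1 hw
  rw [alternates_append] at ha
  obtain ⟨hg₁, hg₂⟩ := ha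
  obtain ⟨hA₁a, -⟩ := (alternates_append _ _).1 hAa
  have hA₁ := hA.of_append_left
  rw [length_append] at hAl hodd h₁ h₂
  -- At its first contact with p, the way A to z₁ can be continued in one direction by parity. Going
  -- on to z₂ contradicts `h₂`, as A has length at most l; going back to z₁ gives r < l by `h₁`.
  by_cases hd : A₁.length % 2 = (l + 1 + g₁.length) % 2
  · have hreach : I.Reach z₂ (A₁.length + g₂.length) := by
      refine ⟨A₁.append g₂, ?_, ?_, by simp⟩
      · rw [isPath_append_iff]
        exact ⟨hA₁, hp.of_append_right, fun x h1 h2 =>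
          hfirst x h1 ((mem_support_append_iff _ _).2 (Or.inr h2))⟩
      · rw [alternates_append]
        exact ⟨hA₁a, hg₂.congr (by omega)⟩
    have h4 := hreach.dist_le
    rw [ofNat_eq_ofNat.2 (show (A₁.length + g₂.length) % 2 = r % 2 by omega)] at h4
    have h5 : g₁.length + g₂.length + l + 1 ≤ A₁.length + g₂.length := by
      exact_mod_cast h₂.trans h4
    omega
  · have hreach : I.Reach z₁ (A₁.length + g₁.length) := by
      refine ⟨A₁.append g₁.reverse, ?_, ?_, by simp⟩
      · rw [isPath_append_iff]
        refine ⟨hA₁, hp.of_append_left.reverse, fun x h1 h2 =>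
          hfirst x h1 ((mem_support_append_iff _ _).2 (Or.inl ?_))⟩
        simpa using h2
      · rw [alternates_append]
        exact ⟨hA₁a, hg₁.reverse (by omega)⟩
    have h4 := hreach.dist_le
    rw [ofNat_eq_ofNat.2 (show (A₁.length + g₁.length) % 2 = l % 2 by omega)] at h4
    have h5 : g₁.length + g₂.length + r + 1 ≤ A₁.length + g₁.length := by
      exact_mod_cast h₁.trans h4
    omega

/-- The properties of the shortest augmenting paths, seen in the extended system, on which the
maximality proof rests: both ways to each of their vertices are known, and the lengths of these ways
add up to at most the tenacities of the two ends. -/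
structure IsThread (K : ℕ) {a b : I.ExtVertex} (S : I.ext.Walk a b) : Prop where
  isPath : S.IsPath
  alternates : S.Alternates I.extMatching.edgeSet 0
  length : S.length + 4 = K
  odd : K % 2 = 1
  reach_left : ∀ {x : I.ExtVertex} (p : I.ext.Walk a x) (q : I.ext.Walk x b), S = p.append q →
    I.Reach x (2 + p.length)
  reach_right : ∀ {x : I.ExtVertex} (p : I.ext.Walk a x) (q : I.ext.Walk x b), S = p.append q →
    I.Reach x (2 + q.length)
  tenacity_fst : (K : ℕ∞) ≤ I.tenacity a
  tenacity_snd : (K : ℕ∞) ≤ I.tenacity b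

lemma le_dist_of_le_volume {y z : I.ExtVertex} {K l : ℕ} (hK : (K : ℕ∞) ≤ I.volume y z)
    (hy : I.Reach y l) (hr : I.rho y z = ofNat l) :
    ((K - l - 1 : ℕ) : ℕ∞) ≤ I.dist (ofNat l) z := by
  have h := hy.dist_le
  by_contra hlt
  rw [not_le] at hlt
  obtain ⟨a, ha⟩ := ENat.ne_top_iff_exists.1 (ne_top_of_le_ne_top (by simp) h)
  obtain ⟨c, hc⟩ := ENat.ne_top_iff_exists.1 (ne_top_of_lt hlt)
  rw [volume, hr, ← ha, ← hc] at hK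
  rw [← hc] at hlt
  rw [← ha] at h
  have h1 : a ≤ l := by exact_mod_cast h
  have h2 : c < K - l - 1 := by exact_mod_cast hlt
  have h3 : K ≤ a + c + 1 := by exact_mod_cast hK
  omega

lemma dist_lt_of_tenacity_lt {z : I.ExtVertex} {K l n : ℕ} (hK : I.tenacity z < K)
    (h : (n : ℕ∞) ≤ I.dist (ofNat l) z) : I.dist (ofNat (l + 1)) z < (K - n : ℕ) := by
  rw [tenacity_eq (ofNat l), PathParity.flip_ofNat] at hK
  have htop := ne_top_of_lt hK
  obtain ⟨a, ha⟩ := ENat.ne_top_iff_exists.1 (fun h : I.dist (ofNat l) z = ⊤ => htop (by simp [h]))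
  obtain ⟨c, hc⟩ := ENat.ne_top_iff_exists.1
    (fun h : I.dist (ofNat (l + 1)) z = ⊤ => htop (by simp [h]))
  rw [← ha, ← hc] at hK
  rw [← ha] at h
  rw [← hc]
  have h1 : a + c < K := by exact_mod_cast hK
  have h2 : n ≤ a := by exact_mod_cast h
  exact_mod_cast (by omega)

/-- A shortest augmenting path contains the first vertex of large tenacity on the way from each of
its vertices to the root of an alternating base tree. -/
theorem IsThread.mem_support_of_mem_bag {K : ℕ} {a b x c : I.ExtVertex} {S : I.ext.Walk a b}
    (hS : IsThread K S) (hx : x ∈ S.support) (hxc : x ∈ T.bag K c) (hc : K ≤ I.tenacity c) :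
    c ∈ S.support := by
  by_contra hcS
  have hten : ∀ y ∈ S.support, y ∈ T.bag K c → I.tenacity y < K := by
    intro y hy hyc
    rcases ABT.mem_bag_cases hyc with rfl | h
    · exact absurd hy hcS
    · exact h.2.1
  have ha : a ∉ T.bag K c := fun h =>
    absurd hS.tenacity_fst (not_le.2 (hten a S.start_mem_support h))
  have hb : b ∉ T.bag K c := fun h =>
    absurd hS.tenacity_snd (not_le.2 (hten b S.end_mem_support h))
  obtain ⟨p, q, rfl⟩ := mem_support_iff_exists_append.1 hx
  -- The stretch of S around x inside the bag, between an entering and a leaving edge, both of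
  -- volume at least K. They exist because the ends have tenacity at least K and so are outside.
  obtain ⟨y₁, z₁, L, e₁, M₁, rfl, hy₁, hM₁⟩ := exists_last_entry _ p ha hxc
  obtain ⟨z₂, y₂, M₂, e₂, N, rfl, hy₂, hM₂⟩ := exists_first_exit _ q hxc hb
  have hz₁ : z₁ ∈ T.bag K c := hM₁ z₁ M₁.start_mem_support
  have hz₂ : z₂ ∈ T.bag K c := hM₂ z₂ M₂.end_mem_support
  have hz₁s := hten z₁ (by simp [mem_support_append_iff]) hz₁
  have hz₂s := hten z₂ (by simp [mem_support_append_iff]) hz₂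
  have hv₁ := ABT.le_volume_of_bag hc e₁ hz₁ hy₁
  have hv₂ := ABT.le_volume_of_bag hc e₂.symm hz₂ hy₂
  clear hten hM₁ hM₂
  have heq : (L.append (.cons e₁ M₁)).append (M₂.append (.cons e₂ N)) =
      L.append (.cons e₁ ((M₁.append M₂).append (.cons e₂ N))) := by
    rw [← append_assoc, cons_append, append_assoc]
  rw [heq] at hS
  generalize M₁.append M₂ = g at hS
  have hly := hS.reach_left L _ rfl
  have hry : I.Reach y₂ (2 + N.length) := by
    refine hS.reach_right (L.append (.cons e₁ (g.concat e₂))) N ?_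
    rw [concat_eq_append, ← append_assoc, cons_append, ← append_assoc, cons_append, nil_append]
  obtain ⟨-, hE₁, halt⟩ := (alternates_append _ _).1 hS.alternates
  obtain ⟨hg, hE₂, -⟩ := (alternates_append _ _).1 halt
  have hlen := hS.length
  have hodd := hS.odd
  simp only [length_append, length_cons] at hlen
  have hgp : g.IsPath := (hS.isPath.of_append_right.of_cons).of_append_left
  have hr₁ : I.rho y₁ z₁ = ofNat (2 + L.length) := by
    rw [rho_eq_ofNat, hE₁]; omega
  have hr₂ : I.rho y₂ z₂ = ofNat (2 + N.length) := by
    rw [rho_comm, rho_eq_ofNat, hE₂]; omega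
  have hd₁ := le_dist_of_le_volume hv₁ hly hr₁
  have hd₂ := le_dist_of_le_volume hv₂ hry hr₂
  have ht₁ := dist_lt_of_tenacity_lt hz₁s hd₁
  have ht₂ := dist_lt_of_tenacity_lt hz₂s hd₂
  have e1 : K - (2 + L.length) - 1 = g.length + (2 + N.length) + 1 := by omega
  have e2 : K - (2 + N.length) - 1 = g.length + (2 + L.length) + 1 := by omega
  rw [e1] at hd₁ ht₁
  rw [e2] at hd₂ ht₂
  have e3 : K - (g.length + (2 + N.length) + 1) = 2 + L.length + 1 := by omega
  have e4 : K - (g.length + (2 + L.length) + 1) = 2 + N.length + 1 := by omega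
  rw [e3] at ht₁
  rw [e4] at ht₂
  -- The situation is symmetric: read from both ends, each outer part of S would be longer than the
  -- other.
  have h1 := lt_of_segment hgp (hg.congr (by omega)) (by omega) hd₁ hd₂ ht₁
  have h2 := lt_of_segment (l := 2 + N.length) (r := 2 + L.length) (p := g.reverse) hgp.reverse (hg.reverse (by omega))
    (by rw [length_reverse]; omega) (by rwa [length_reverse]) (by rwa [length_reverse]) ht₂
  omega

end MatchingSystem

/-! ### Transfer between the original and the extended graph; trees of free vertices. -/

namespace MatchingSystem

open PathParity (ofNat ofNat_eq_ofNat)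
open SimpleGraph SimpleGraph.Walk

variable {V : Type*} {I : MatchingSystem V} {T : I.ABT}

lemma origHom_injective : Function.Injective I.origHom := fun _ _ h => ExtVertex.orig.inj h

/-- A walk of the original graph as a walk of the extended graph. -/
def extWalk {a b : V} (p : I.graph.Walk a b) : I.ext.Walk (.orig a) (.orig b) :=
  p.map I.origHom

@[simp] lemma length_extWalk {a b : V} (p : I.graph.Walk a b) : (extWalk p).length = p.length :=
  length_map _ _

lemma exists_of_mem_support_extWalk {a b : V} {p : I.graph.Walk a b} {x : I.ExtVertex}
    (hx : x ∈ (extWalk p).support) : ∃ v ∈ p.support, x = .orig v := by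
  have hx : x ∈ (p.map I.origHom).support := hx
  rw [Walk.support_map, List.mem_map] at hx
  obtain ⟨v, hv, rfl⟩ := hx
  exact ⟨v, hv, rfl⟩

lemma mem_support_extWalk {a b : V} {p : I.graph.Walk a b} {x : V} :
    (.orig x : I.ExtVertex) ∈ (extWalk p).support ↔ x ∈ p.support := by
  constructor
  · intro h
    obtain ⟨v, hv, h⟩ := exists_of_mem_support_extWalk h
    rwa [ExtVertex.orig.inj h]
  · intro h
    have : (.orig x : I.ExtVertex) ∈ (p.map I.origHom).support := by
      rw [Walk.support_map, List.mem_map]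
      exact ⟨x, h, rfl⟩
    exact this

lemma extWalk_isPath {a b : V} {p : I.graph.Walk a b} : (extWalk p).IsPath ↔ p.IsPath :=
  isPath_map_iff_of_injective origHom_injective

lemma extWalk_alternates {a b : V} {p : I.graph.Walk a b} {n : ℕ} :
    (extWalk p).Alternates I.extMatching.edgeSet n ↔ p.Alternates I.matching.edgeSet n :=
  Alternates.map I.origHom (fun _ _ => Iff.rfl) p

lemma extWalk_injective {a b : V} :
    Function.Injective (extWalk : I.graph.Walk a b → I.ext.Walk (.orig a) (.orig b)) :=
  map_injective_of_injective origHom_injective _ _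

lemma exists_extWalk_eq {x y : I.ExtVertex} (p : I.ext.Walk x y) :
    ∀ {a b : V} (hx : x = .orig a) (hy : y = .orig b),
      (∀ w ∈ p.support, ∃ v, w = .orig v) →
      ∃ q : I.graph.Walk a b, extWalk q = p.copy hx hy := by
  induction p with
  | nil =>
    rintro a b rfl hy -
    obtain rfl := ExtVertex.orig.inj hy
    exact ⟨.nil, rfl⟩
  | @cons x c y h p ih =>
    rintro a b rfl rfl hs
    obtain ⟨v, rfl⟩ := hs c (by simp)
    obtain ⟨q, hq⟩ := ih rfl rfl fun w hw => hs w (by simp [hw])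
    refine ⟨.cons h q, ?_⟩
    rw [copy_rfl_rfl] at hq ⊢
    rw [← hq]
    rfl

/-- A path entering `mid u` from u can leave it only to `root`. -/
lemma exists_orig_of_isPath {x y : I.ExtVertex} (p : I.ext.Walk x y) :
    ∀ {a b : V}, x = .orig a → y = .orig b → p.IsPath → .root ∉ p.support →
      ∀ w ∈ p.support, ∃ v, w = .orig v := by
  induction p with
  | nil =>
    rintro a b rfl - - - w hw
    rw [support_nil, List.mem_singleton] at hw
    exact ⟨a, hw⟩
  | @cons x c y h p ih =>
    rintro a b rfl rfl hp hr w hw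
    rw [support_cons, List.mem_cons, not_or] at hr
    rw [cons_isPath_iff] at hp
    rw [support_cons, List.mem_cons] at hw
    rcases hw with rfl | hw
    · exact ⟨a, rfl⟩
    rcases c with c | c | _
    · exact ih rfl rfl hp.1 hr.2 w hw
    · exfalso
      cases p with
      | @cons _ d _ h' p =>
        rcases d with d | d | _
        · have h1 : a = c := h
          have h2 : d = c := h'
          apply hp.2
          rw [support_cons, List.mem_cons, h1, ← h2]
          exact Or.inr p.start_mem_support
        · exact h'
        · exact hr.2 (by simp)
    · exact absurd h id

lemma notMem_edgeSet_of_free {u v : V} (hu : u ∈ I.free) : s(u, v) ∉ I.matching.edgeSet := by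
  rw [Subgraph.mem_edgeSet]
  exact fun h => hu h.fst_mem

lemma IsAugmentingPath.alternates {u v : V} {p : I.graph.Walk u v} (h : I.IsAugmentingPath p) :
    p.IsPath ∧ p.Alternates I.matching.edgeSet 0 ∧ p.length % 2 = 1 := by
  obtain ⟨⟨hp, hc⟩, hne, hu, hv⟩ := h
  obtain ⟨n, hn⟩ := (edges_isChain_xor_iff p).1 hc
  have hn0 : n % 2 = 0 % 2 := by
    cases p with
    | nil => exact absurd rfl hne
    | cons h p =>
      have := hn.1
      simp only [notMem_edgeSet_of_free hu, false_iff] at this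
      omega
  replace hn := hn.congr hn0
  refine ⟨hp, hn, ?_⟩
  have hl : p.length ≠ 0 := fun h => hne (Walk.eq_of_length_eq_zero h)
  have h1 := alternates_getVert hn (i := p.length - 1) (by omega)
  rw [Nat.sub_add_cancel (by omega), getVert_length, Sym2.eq_swap] at h1
  simp only [notMem_edgeSet_of_free hv, false_iff] at h1
  omega

lemma isAugmentingPath_of_alternates {u v : V} {p : I.graph.Walk u v} {n : ℕ} (hp : p.IsPath)
    (ha : p.Alternates I.matching.edgeSet n) (hne : u ≠ v) (hu : u ∈ I.free) (hv : v ∈ I.free) :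
    I.IsAugmentingPath p :=
  ⟨⟨hp, (edges_isChain_xor_iff p).2 ⟨n, ha⟩⟩, hne, hu, hv⟩

lemma Reach.two_le {v : V} {n : ℕ} (h : I.Reach (.orig v) n) : 2 ≤ n := by
  obtain ⟨p, -, -, rfl⟩ := h
  cases p with
  | cons h p =>
    cases p with
    | nil => exact absurd h id
    | cons h' p => simp

lemma two_le_orthDist (v : V) : 2 ≤ I.orthDist (.orig v) := by
  by_contra h
  rw [not_le] at h
  obtain ⟨n, hn⟩ := ENat.ne_top_iff_exists.1 (ne_top_of_lt h)
  rw [← hn] at h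
  have := (reach_of_orthDist_eq hn.symm).1.two_le
  have h2 : n < 2 := by exact_mod_cast h
  omega

/-- The path of length two from the super free vertex to a free vertex. -/
def stem {u : V} (hu : u ∈ I.free) : I.ext.Walk .root (.orig u) :=
  .cons (show I.ext.Adj .root (.mid ⟨u, hu⟩) from trivial)
    (.cons (show I.ext.Adj (.mid ⟨u, hu⟩) (.orig u) from rfl) .nil)

lemma stem_isPath {u : V} (hu : u ∈ I.free) : (stem hu).IsPath := by
  simp [stem, cons_isPath_iff]

lemma stem_alternates {u : V} (hu : u ∈ I.free) :
    (stem hu).Alternates I.extMatching.edgeSet 0 := by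
  refine ⟨?_, ?_, trivial⟩
  · rw [SimpleGraph.mem_edgeSet]
    exact ⟨fun h => absurd h id, fun h => by omega⟩
  · rw [SimpleGraph.mem_edgeSet]
    exact ⟨fun _ => rfl, fun _ => rfl⟩

lemma orthDist_free {u : V} (hu : u ∈ I.free) : I.orthDist (.orig u) = (2 : ℕ) :=
  le_antisymm (Reach.orthDist_le ⟨stem hu, stem_isPath hu, stem_alternates hu, rfl⟩)
    (two_le_orthDist u)

lemma reach_of_alternates {u x : V} (hu : u ∈ I.free) {p : I.ext.Walk (.orig u) (.orig x)}
    (hp : p.IsPath) (ha : p.Alternates I.extMatching.edgeSet 0)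
    (hs : ∀ w ∈ p.support, ∃ v, w = .orig v) : I.Reach (.orig x) (2 + p.length) := by
  refine ⟨(stem hu).append p, ?_, ?_, by simp [stem]; omega⟩
  · rw [isPath_append_iff]
    refine ⟨stem_isPath hu, hp, fun w h1 h2 => ?_⟩
    obtain ⟨v, rfl⟩ := hs w h2
    simpa [stem] using h1
  · rw [alternates_append]
    exact ⟨stem_alternates hu, ha.congr (by simp [stem])⟩

/-- The path starts with the stem of some free u'. If u' = u, the rest is trivial and the length is
even. -/
lemma exists_isAugmentingPath_of_reach {u : V} (hu : u ∈ I.free) {n : ℕ}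
    (h : I.Reach (.orig u) n) (hn : n % 2 = 1) :
    ∃ (u' : V) (p : I.graph.Walk u' u), I.IsAugmentingPath p ∧ p.length + 2 = n := by
  obtain ⟨p, hp, ha, rfl⟩ := h
  cases p with
  | @cons _ b _ h p =>
    rcases b with b | u' | _
    · exact absurd h id
    · cases p with
      | @cons _ c _ h' p =>
        rcases c with c | c | _
        · obtain ⟨u', hu'⟩ := u'
          have hc : c = u' := h'
          subst hc
          rw [cons_isPath_iff, cons_isPath_iff, support_cons, List.mem_cons, not_or] at hp
          have hs := exists_orig_of_isPath p rfl rfl hp.1.1 hp.2.2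
          obtain ⟨q, hq⟩ := exists_extWalk_eq p rfl rfl hs
          rw [copy_rfl_rfl] at hq
          subst hq
          have hq : q.IsPath := extWalk_isPath.1 hp.1.1
          have hqa := extWalk_alternates.1 ha.2.2
          simp only [length_cons, length_extWalk] at hn ⊢
          refine ⟨c, q, isAugmentingPath_of_alternates hq hqa ?_ hu' hu, rfl⟩
          rintro rfl
          rw [isPath_iff_nil, ← eq_nil_iff_nil] at hq
          subst hq
          simp at hn
        · exact absurd h' id
        · simp [cons_isPath_iff] at hp
    · exact absurd h id

/-- An odd path to u is a stem followed by an augmenting path, so it has length at least l + 2; the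
even distance is at least 2. -/
lemma le_tenacity_free {u : V} (hu : u ∈ I.free) {l : ℕ}
    (hl : ∀ (u' v' : V) (p : I.graph.Walk u' v'), I.IsAugmentingPath p → l ≤ p.length) :
    ((l + 4 : ℕ) : ℕ∞) ≤ I.tenacity (.orig u) := by
  have h1 : ((l + 2 : ℕ) : ℕ∞) ≤ I.dist .odd (.orig u) := by
    by_contra h
    rw [not_le] at h
    obtain ⟨n, hn⟩ := ENat.ne_top_iff_exists.1 (ne_top_of_lt h)
    rw [← hn] at h
    have h' : n < l + 2 := by exact_mod_cast h
    obtain ⟨h2, h3⟩ := reach_of_dist_eq hn.symm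
    have h4 : n % 2 = 1 := by
      by_contra h4
      simp [ofNat, h4] at h3
    obtain ⟨u', p, hp, hpl⟩ := exists_isAugmentingPath_of_reach hu h2 h4
    have := hl _ _ p hp
    omega
  have h2 : ((2 : ℕ) : ℕ∞) ≤ I.dist .even (.orig u) := (two_le_orthDist u).trans
    (orthDist_le_dist .even _)
  refine le_trans ?_ (add_le_add h1 h2)
  exact_mod_cast (by omega)

lemma IsShortestAugmentingPath.isThread {u v : V} {p : I.graph.Walk u v}
    (h : I.IsShortestAugmentingPath p) : IsThread (p.length + 4) (extWalk p) := by
  obtain ⟨hp, ha, hodd⟩ := h.1.alternates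
  have hu := h.1.2.2.1
  have hv := h.1.2.2.2
  have hP : (extWalk p).IsPath := extWalk_isPath.2 hp
  have hA := extWalk_alternates.2 ha
  have hten : ∀ {w : V}, w ∈ I.free →
      ((p.length + 4 : ℕ) : ℕ∞) ≤ I.tenacity (.orig w) :=
    fun hw => le_tenacity_free hw h.2
  refine ⟨hP, hA, by rw [length_extWalk], by omega, ?_, ?_, hten hu, hten hv⟩
  · intro x q r hqr
    have hs : ∀ w ∈ (q.append r).support, ∃ v, w = .orig v := fun w hw => by
      rw [← hqr] at hw
      obtain ⟨v, -, hv⟩ := exists_of_mem_support_extWalk hw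
      exact ⟨v, hv⟩
    obtain ⟨x, rfl⟩ := hs x (by simp [mem_support_append_iff])
    rw [hqr] at hP hA
    exact reach_of_alternates hu hP.of_append_left ((alternates_append _ _).1 hA).1
      fun w hw => hs w (by rw [mem_support_append_iff]; exact Or.inl hw)
  · intro x q r hqr
    have hs : ∀ w ∈ (q.append r).support, ∃ v, w = .orig v := fun w hw => by
      rw [← hqr] at hw
      obtain ⟨v, -, hv⟩ := exists_of_mem_support_extWalk hw
      exact ⟨v, hv⟩
    obtain ⟨x, rfl⟩ := hs x (by simp [mem_support_append_iff])
    have hlen : p.length = q.length + r.length := by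
      rw [← length_append, ← hqr, length_extWalk]
    rw [hqr] at hP hA
    have := reach_of_alternates hv (p := r.reverse) hP.of_append_right.reverse
      (((alternates_append _ _).1 hA).2.reverse (by omega))
      fun w hw => hs w (by
        rw [support_reverse, List.mem_reverse] at hw
        rw [mem_support_append_iff]; exact Or.inr hw)
    rwa [length_reverse] at this

namespace ABT

/-- A `mid` vertex is at distance at most 1, too close to descend from an original vertex. -/
lemma exists_orig_of_mem_subtree {x : I.ExtVertex} {u : V} (hx : x ∈ T.subtree (.orig u)) :
    ∃ v, x = .orig v := by
  induction hx using Relation.ReflTransGen.head_induction_on with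
  | refl => exact ⟨u, rfl⟩
  | @head x c h _ ih =>
    obtain ⟨w, rfl⟩ := ih
    rcases x with v | v | _
    · exact ⟨v, rfl⟩
    · have h1 : I.Reach (.mid v) 1 := by
        refine ⟨.cons (show I.ext.Adj .root (.mid v) from trivial) .nil, ?_, ⟨?_, trivial⟩, rfl⟩
        · simp [cons_isPath_iff]
        · rw [SimpleGraph.mem_edgeSet]
          exact ⟨fun h => absurd h id, fun h => by omega⟩
      have h2 := (two_le_orthDist w).trans_lt (h.orthDist_lt.trans_le h1.orthDist_le)
      exact absurd h2 (by decide)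
    · exact absurd h not_isParent_root

lemma not_isParent_of_free {u w : V} (hu : u ∈ I.free) :
    ¬ T.IsParent (.orig u) (.orig w) := fun h => by
  have h1 := (two_le_orthDist w).trans_lt h.orthDist_lt
  rw [orthDist_free hu] at h1
  exact absurd h1 (by decide)

lemma eq_of_mem_subtree_of_free {u u' : V} (hu : u ∈ I.free)
    (h : (.orig u : I.ExtVertex) ∈ T.subtree (.orig u')) : u = u' := by
  rcases mem_subtree_cases h with h | ⟨h1, h2⟩
  · exact ExtVertex.orig.inj h
  · obtain ⟨w, hw⟩ := exists_orig_of_mem_subtree h2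
    rw [hw] at h1
    exact absurd h1 (not_isParent_of_free hu)

lemma eq_of_mem_subtrees {x : I.ExtVertex} {u u' : V} (hu : u ∈ I.free) (hu' : u' ∈ I.free)
    (h : x ∈ T.subtree (.orig u)) (h' : x ∈ T.subtree (.orig u')) : u = u' := by
  rcases mem_subtree_total h h' with h | h
  · exact eq_of_mem_subtree_of_free hu h
  · exact (eq_of_mem_subtree_of_free hu' h).symm

lemma IsRootOf.unique {u u' v : V} (h : T.IsRootOf u v) (h' : T.IsRootOf u' v) : u = u' :=
  eq_of_mem_subtrees h.1 h'.1 h.2 h'.2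

lemma mem_subtree_of_darts {a b : V} (P : I.graph.Walk a b)
    (h : ∀ e ∈ P.darts, T.IsParent (.orig e.fst) (.orig e.snd)) :
    (.orig a : I.ExtVertex) ∈ T.subtree (.orig b) := by
  induction P with
  | nil => exact mem_subtree_self _
  | cons e P ih =>
    exact (h _ List.mem_cons_self).mem_subtree (ih fun e he => h e (List.mem_cons_of_mem _ he))

lemma mem_subtrees_of_mem_support {a b x : V} {P : I.graph.Walk a b}
    (h : ∀ e ∈ P.darts, T.IsParent (.orig e.fst) (.orig e.snd)) (hx : x ∈ P.support) :
    (.orig a : I.ExtVertex) ∈ T.subtree (.orig x) ∧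
      (.orig x : I.ExtVertex) ∈ T.subtree (.orig b) := by
  obtain ⟨p, q, rfl⟩ := mem_support_iff_exists_append.1 hx
  rw [darts_append] at h
  exact ⟨mem_subtree_of_darts p fun e he => h e (List.mem_append_left _ he),
    mem_subtree_of_darts q fun e he => h e (List.mem_append_right _ he)⟩

/-- The tree path from a vertex to an ancestor. -/
lemma exists_treePath {a b : V} (h : (.orig a : I.ExtVertex) ∈ T.subtree (.orig b)) :
    ∃ P : I.graph.Walk a b, P.IsPath ∧
      ∀ e ∈ P.darts, T.IsParent (.orig e.fst) (.orig e.snd) := by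
  generalize hx : (.orig a : I.ExtVertex) = x at h
  induction h using Relation.ReflTransGen.head_induction_on generalizing a with
  | refl =>
    obtain rfl := ExtVertex.orig.inj hx
    exact ⟨.nil, by simp, by simp⟩
  | @head x c h h' ih =>
    subst hx
    obtain ⟨w, rfl⟩ := exists_orig_of_mem_subtree h'
    obtain ⟨P, hP, hd⟩ := ih rfl
    have hadj : I.graph.Adj a w := h.adj.symm
    refine ⟨.cons hadj P, hP.cons fun ha => ?_, fun e he => ?_⟩
    · have := orthDist_le_of_mem_subtree (mem_subtrees_of_mem_support hd ha).1
      exact absurd h.orthDist_lt (not_lt.2 this)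
    · rw [darts_cons, List.mem_cons] at he
      rcases he with rfl | he
      · exact h
      · exact hd e he

/-- The three rules exclude each other, so the relation is a partial function and each double path
has at most one output. -/
lemma PathConstruction.unique {m : I.ExtVertex → I.ExtVertex × I.ExtVertex} {s t : I.ExtVertex}
    {θ : PathParity} {p q : I.ext.Walk s t} (hp : T.PathConstruction m s t θ p)
    (hq : T.PathConstruction m s t θ q) : p = q := by
  induction hp with
  | base s θ =>
    cases hq with
    | base => rfl
    | orthodox _ _ _ _ h => exact absurd rfl h
    | unorthodox _ _ _ _ _ _ _ h => exact absurd rfl h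
  | orthodox s t θ X hst hθ h hX ih =>
    cases hq with
    | base => exact absurd rfl hst
    | orthodox _ _ _ X' _ _ _ hX' => rw [ih hX']
    | unorthodox _ _ _ _ _ _ _ _ h => exact absurd hθ h
  | unorthodox s t y z θ Y Z hst hθ hm h hY hZ ihY ihZ =>
    cases hq with
    | base => exact absurd rfl hst
    | orthodox _ _ _ _ _ h => exact absurd h hθ
    | unorthodox _ _ y' z' _ Y' Z' _ _ hm' h' hY' hZ' =>
      obtain ⟨rfl, rfl⟩ := Prod.mk.inj (hm.symm.trans hm')
      rw [ihY hY', ihZ hZ']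

end ABT

lemma DoubleToAug.unique {m : I.ExtVertex → I.ExtVertex × I.ExtVertex} {d : I.DoublePath}
    {q q' : I.AnyWalk} (h : DoubleToAug T m d q) (h' : DoubleToAug T m d q') : q = q' := by
  obtain ⟨h1, h2, Y, Z, h3, hY, hZ, hq⟩ := h
  obtain ⟨h1', h2', Y', Z', h3', hY', hZ', hq'⟩ := h'
  obtain ⟨s, t, w⟩ := q
  obtain ⟨s', t', w'⟩ := q'
  obtain rfl : s = s' := h1.unique h1'
  obtain rfl : t = t' := h2.unique h2'
  dsimp only at *
  obtain rfl := hY.unique hY'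
  obtain rfl := hZ.unique hZ'
  congr 1
  exact extWalk_injective (hq.trans hq'.symm)

end MatchingSystem

/-! ### Double paths and their augmenting paths. -/

namespace MatchingSystem

open PathParity (ofNat ofNat_eq_ofNat)
open SimpleGraph SimpleGraph.Walk

variable {V : Type*} {I : MatchingSystem V} {T : I.ABT}

/-- An alternating base tree exists. -/
lemma exists_abt (I : MatchingSystem V) : Nonempty I.ABT := by
  classical
  have key : ∀ a : I.ExtVertex, ∃ b, (I.parents a).Nonempty → b ∈ I.parents a := fun a => by
    by_cases h : (I.parents a).Nonempty
    · exact ⟨h.some, fun _ => h.some_mem⟩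
    · exact ⟨a, fun h' => absurd h' h⟩
  choose f hf using key
  exact ⟨⟨f, hf⟩⟩

/-- The parents in an alternating base tree can be prescribed by any functional relation. -/
lemma exists_abt_of_rel (T : I.ABT) (r : I.ExtVertex → I.ExtVertex → Prop)
    (hr : ∀ a b, r a b → b ∈ I.parents a) (hu : ∀ a b c, r a b → r a c → b = c) :
    ∃ T' : I.ABT, (∀ a b, r a b → T'.IsParent a b) ∧
      ∀ a, (∀ b, ¬ r a b) → T'.parent a = T.parent a := by
  classical
  have key : ∀ a : I.ExtVertex, ∃ b, ((I.parents a).Nonempty → b ∈ I.parents a) ∧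
      (∀ c, r a c → b = c) ∧ ((∀ c, ¬ r a c) → b = T.parent a) := fun a => by
    by_cases h : ∃ b, r a b
    · obtain ⟨b, hb⟩ := h
      exact ⟨b, fun _ => hr a b hb, fun c hc => hu a b c hb hc, fun h => absurd hb (h b)⟩
    · exact ⟨T.parent a, T.parent_mem a, fun c hc => absurd ⟨c, hc⟩ h, fun _ => rfl⟩
  choose f hf using key
  exact ⟨⟨f, fun a => (hf a).1⟩, fun a b h => ⟨⟨b, hr a b h⟩, (hf a).2.1 b h⟩,
    fun a => (hf a).2.2⟩

lemma eq_of_mem_darts {G : SimpleGraph V} {a b : V} {p : G.Walk a b} (hp : p.IsPath) {e e' : G.Dart}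
    (he : e ∈ p.darts) (he' : e' ∈ p.darts) (h : e.fst = e'.fst) : e = e' := by
  refine List.inj_on_of_nodup_map (f := fun d : G.Dart => d.fst) ?_ he he' h
  rw [map_fst_darts]
  exact hp.support_nodup.sublist (List.dropLast_sublist _)

/-- The darts of the two paths of a double path. -/
def DoublePath.IsDart (d : I.DoublePath) (e : I.graph.Dart) : Prop :=
  e ∈ d.P.darts ∨ e ∈ d.Q.darts

lemma DoublePath.IsDart.mem_verts {d : I.DoublePath} {e : I.graph.Dart} (h : d.IsDart e) :
    e.fst ∈ d.verts :=
  h.imp (fun h => dart_fst_mem_support_of_mem_darts _ h)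
    fun h => dart_fst_mem_support_of_mem_darts _ h

lemma DoublePath.IsDart.adj {d : I.DoublePath} {e : I.graph.Dart} (h : d.IsDart e) :
    I.baseDAG.Adj e.fst e.snd :=
  h.elim (d.dag_P e) (d.dag_Q e)

lemma DoublePath.IsDart.eq {d : I.DoublePath} {e e' : I.graph.Dart} (h : d.IsDart e)
    (h' : d.IsDart e') (hee : e.fst = e'.fst) : e = e' := by
  rcases h with h | h <;> rcases h' with h' | h'
  · exact eq_of_mem_darts d.isPath_P h h' hee
  · refine absurd (dart_fst_mem_support_of_mem_darts _ h') (d.disjoint _ ?_)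
    rw [← hee]
    exact dart_fst_mem_support_of_mem_darts _ h
  · refine absurd (dart_fst_mem_support_of_mem_darts _ h) (d.disjoint _ ?_)
    rw [hee]
    exact dart_fst_mem_support_of_mem_darts _ h'
  · exact eq_of_mem_darts d.isPath_Q h h' hee

/-- Arcs of disjoint double paths have distinct tails, so they prescribe at most one parent per
vertex. -/
theorem IsDisjointDoublePaths.exists_respects {D : Set I.DoublePath}
    (hD : I.IsDisjointDoublePaths D) : ∃ T : I.ABT, ∀ d ∈ D, T.Respects d := by
  obtain ⟨T₀⟩ := exists_abt I
  have hr : ∀ a b : I.ExtVertex,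
      (∃ d ∈ D, ∃ e, d.IsDart e ∧ a = .orig e.fst ∧ b = .orig e.snd) → b ∈ I.parents a := by
    rintro a b ⟨d, -, e, he, rfl, rfl⟩
    exact he.adj.2
  obtain ⟨T, hT, -⟩ := exists_abt_of_rel T₀ _ hr (by
    rintro a b c ⟨d, hd, e, he, rfl, rfl⟩ ⟨d', hd', e', he', h, rfl⟩
    have hee := ExtVertex.orig.inj h
    have hdd : d = d' := by
      by_contra hne
      refine Set.disjoint_left.1 (hD hd hd' hne) he.mem_verts ?_
      rw [hee]
      exact he'.mem_verts
    subst hdd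
    rw [he.eq he' hee])
  exact ⟨T, fun d hd => ⟨fun e he => hT _ _ ⟨d, hd, e, Or.inl he, rfl, rfl⟩,
    fun e he => hT _ _ ⟨d, hd, e, Or.inr he, rfl, rfl⟩⟩⟩

lemma ABT.Respects.mem_subtrees {d : I.DoublePath} (h : T.Respects d) {x : V} (hx : x ∈ d.verts) :
    ((.orig d.y : I.ExtVertex) ∈ T.subtree (.orig x) ∧
      (.orig x : I.ExtVertex) ∈ T.subtree (.orig d.u)) ∨
    ((.orig d.z : I.ExtVertex) ∈ T.subtree (.orig x) ∧
      (.orig x : I.ExtVertex) ∈ T.subtree (.orig d.v)) :=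
  hx.imp (ABT.mem_subtrees_of_mem_support h.1) (ABT.mem_subtrees_of_mem_support h.2)

lemma ABT.levelGE_of_le_tenacity {K : ℕ∞} {t : I.ExtVertex} (ht : I.orthDist t ≠ ⊤)
    (hK : K ≤ I.tenacity t) : T.LevelGE (toLex (K, 0)) t := fun y z h => by
  rw [level, Prod.Lex.toLex_le_toLex]
  rcases (hK.trans (tenacity_le_of_isIncoming ht h)).lt_or_eq with h | h
  · exact Or.inl h
  · exact Or.inr ⟨h, by simp⟩

/-- The procedure DoubleToAug is correct. -/
theorem exists_doubleToAug {m : I.ExtVertex → I.ExtVertex × I.ExtVertex} (hm : T.IsMIEChoice m)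
    {d : I.DoublePath} (hd : T.Respects d) :
    ∃ q : I.AnyWalk, DoubleToAug T m d q ∧ I.IsShortestAugmentingPath q.walk ∧
      q.src = d.u ∧ q.tgt = d.v ∧
      (∀ x ∈ q.verts, (.orig x : I.ExtVertex) ∈ T.subtree (.orig d.u) ∨
        (.orig x : I.ExtVertex) ∈ T.subtree (.orig d.v)) ∧
      ∀ x ∈ d.verts, ∀ c, (.orig x : I.ExtVertex) ∈ T.subtree c →
        I.volume (.orig d.y) (.orig d.z) ≤ I.tenacity c →
        c ∈ T.subtree (.orig d.u) ∨ c ∈ T.subtree (.orig d.v) → ∃ w ∈ q.verts, c = .orig w := by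
  obtain ⟨hadj, ⟨ℓ, ⟨u', v', p', hp', hpl'⟩, hvol⟩, -⟩ := d.crossable
  have hyu : (.orig d.y : I.ExtVertex) ∈ T.subtree (.orig d.u) := ABT.mem_subtree_of_darts _ hd.1
  have hzv : (.orig d.z : I.ExtVertex) ∈ T.subtree (.orig d.v) := ABT.mem_subtree_of_darts _ hd.2
  have hyv : (.orig d.y : I.ExtVertex) ∉ T.subtree (.orig d.v) :=
    fun h => d.u_ne_v (ABT.eq_of_mem_subtrees d.u_free d.v_free hyu h)
  have hzu : (.orig d.z : I.ExtVertex) ∉ T.subtree (.orig d.u) :=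
    fun h => d.u_ne_v (ABT.eq_of_mem_subtrees d.u_free d.v_free h hzv)
  have hmin : ∀ (u v : V) (p : I.graph.Walk u v), I.IsAugmentingPath p → 2 * ℓ + 1 ≤ p.length :=
    fun u v p hp => hpl' ▸ hp'.2 u v p hp
  have hK : ∀ {w : V}, w ∈ I.free →
      I.volume (.orig d.y) (.orig d.z) ≤ I.tenacity (.orig w) := fun hw => by
    rw [hvol]; exact le_tenacity_free hw hmin
  have htop : I.volume (.orig d.y : I.ExtVertex) (.orig d.z) ≠ ⊤ := by rw [hvol]; exact ENat.natCast_ne_top _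
  have hfree : ∀ {w : V}, w ∈ I.free → I.orthDist (.orig w) ≠ ⊤ := fun hw => by
    rw [orthDist_free hw]; simp
  obtain ⟨a, c, ha, hc, -, -, hra, hrc, hvac⟩ := exists_dist_of_volume_ne_top htop
  have hlen : 2 * ℓ + 5 = a + c + 1 := by rw [hvac] at hvol; exact_mod_cast hvol.symm
  have hadj' : I.ext.Adj (.orig d.y) (.orig d.z) := hadj
  have hLu := ABT.levelGE_of_le_tenacity (T := T) (hfree d.u_free) (hK d.u_free)
  have hLv := ABT.levelGE_of_le_tenacity (T := T) (hfree d.v_free) (hK d.v_free)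
  obtain ⟨Y, hY1, hY2, hY3, hY4, hY5, hY6, hY7⟩ :=
    ABT.exists_pathConstruction hm _ a (.orig d.u) (.orig d.y) _ 2 (orthDist_free d.u_free) hLu
      hyu ha (by
        have := ABT.levelBound_of_critical hm hadj'.symm (by rwa [volume_comm]) d.critical.2
        rwa [volume_comm, rho_comm] at this)
  obtain ⟨Z, hZ1, hZ2, hZ3, hZ4, hZ5, hZ6, hZ7⟩ :=
    ABT.exists_pathConstruction hm _ c (.orig d.v) (.orig d.z) _ 2 (orthDist_free d.v_free) hLv
      hzv hc (ABT.levelBound_of_critical hm hadj' htop d.critical.1)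
  obtain ⟨h1, h2, h3⟩ := ABT.append_cons_reverse (T := T) hadj' hY2 hY3 hY4 (hY6 _ hLv hyv)
    hZ2 hZ3 hZ4 (by rw [hY5, hra]) (by rw [hZ5, hrc])
  obtain ⟨q, hq⟩ := exists_extWalk_eq (Y.append (.cons hadj' Z.reverse)) rfl rfl
    fun w hw => (h3 w hw).elim ABT.exists_orig_of_mem_subtree ABT.exists_orig_of_mem_subtree
  rw [copy_rfl_rfl] at hq
  rw [← hq] at h1 h2 h3
  -- The halves have lengths a - 2 and c - 2, and a + c + 1 = 2ℓ + 5.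
  have hql : q.length = 2 * ℓ + 1 := by
    rw [← length_extWalk, hq]
    simp only [length_append, length_cons, length_reverse]
    omega
  refine ⟨⟨d.u, d.v, q⟩, ⟨⟨d.u_free, hyu⟩, ⟨d.v_free, hzv⟩, Y, Z, hadj', hY1, hZ1, hq⟩,
    ⟨isAugmentingPath_of_alternates (extWalk_isPath.1 h1) (extWalk_alternates.1 h2) d.u_ne_v
      d.u_free d.v_free, fun u v p hp => hql ▸ hmin u v p hp⟩, rfl, rfl,
    fun x hx => h3 _ (mem_support_extWalk.2 hx), ?_⟩
  intro x hx b hxb hKb hb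
  have hmem : b ∈ (extWalk q).support := by
    have hbtop : I.orthDist b ≠ ⊤ := by
      have hx' : I.orthDist (.orig x) ≠ ⊤ := by
        rcases hd.mem_subtrees hx with h | h
        · refine ne_top_of_le_ne_top ?_ (ABT.orthDist_le_of_mem_subtree h.1)
          exact ne_top_of_le_ne_top (by rw [ha]; simp) (orthDist_le_dist _ _)
        · refine ne_top_of_le_ne_top ?_ (ABT.orthDist_le_of_mem_subtree h.1)
          exact ne_top_of_le_ne_top (by rw [hc]; simp) (orthDist_le_dist _ _)
      exact ne_top_of_le_ne_top hx' (ABT.orthDist_le_of_mem_subtree hxb)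
    have hLb := ABT.levelGE_of_le_tenacity (T := T) hbtop hKb
    rw [hq, mem_support_append_iff, support_cons, List.mem_cons, support_reverse, List.mem_reverse]
    rcases hd.mem_subtrees hx with h | h
    · have hbu : b ∈ T.subtree (.orig d.u) := by
        refine hb.resolve_right fun hbv => d.u_ne_v ?_
        exact ABT.eq_of_mem_subtrees d.u_free d.v_free h.2 (ABT.subtree_subset hbv hxb)
      exact Or.inl (hY7 b hLb (ABT.subtree_subset hxb h.1) hbu)
    · have hbv : b ∈ T.subtree (.orig d.v) := by
        refine hb.resolve_left fun hbu => d.u_ne_v ?_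
        exact ABT.eq_of_mem_subtrees d.u_free d.v_free (ABT.subtree_subset hbu hxb) h.2
      exact Or.inr (Or.inr (hZ7 b hLb (ABT.subtree_subset hxb h.1) hbv))
  obtain ⟨w, hw, rfl⟩ := exists_of_mem_support_extWalk hmem
  exact ⟨w, hw, rfl⟩

/-- A shortest augmenting path that meets a double path meets the output of DoubleToAug. -/
theorem exists_mem_of_mem_verts {m : I.ExtVertex → I.ExtVertex × I.ExtVertex}
    (hm : T.IsMIEChoice m) {d : I.DoublePath} (hd : T.Respects d) {q r : I.AnyWalk}
    (hq : DoubleToAug T m d q) (hr : I.IsShortestAugmentingPath r.walk) {x : V} (hxd : x ∈ d.verts)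
    (hxr : x ∈ r.verts) : ∃ w ∈ q.verts, w ∈ r.verts := by
  obtain ⟨q', hq', -, -, -, -, hmem⟩ := exists_doubleToAug hm hd
  obtain rfl := hq.unique hq'
  obtain ⟨hadj, ⟨ℓ, ⟨u', v', p', hp', hpl'⟩, hvol⟩, -⟩ := d.crossable
  have hth := hr.isThread
  have hlen : r.walk.length = 2 * ℓ + 1 := by
    rw [← hpl']
    exact le_antisymm (hr.2 _ _ _ hp'.1) (hp'.2 _ _ _ hr.1)
  rw [hlen] at hth
  have hxS := mem_support_extWalk (I := I).2 hxr
  have hfree : ∀ {w : V}, w ∈ I.free → ((2 * ℓ + 1 + 4 : ℕ) : ℕ∞) ≤ I.tenacity (.orig w) :=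
    fun hw => le_tenacity_free hw fun u v p hp => hpl' ▸ hp'.2 u v p hp
  have hxtop : I.orthDist (.orig x) ≠ ⊤ := by
    obtain ⟨p, q, hpq⟩ := mem_support_iff_exists_append.1 hxS
    exact ne_top_of_le_ne_top (by simp) (hth.reach_left p q hpq).orthDist_le
  -- The base c of the bag of x is the common vertex: it is on r by the bag argument and on q
  -- because PathConstruction passes through such ancestors.
  obtain ⟨c, hxc, hKc⟩ := ABT.exists_mem_bag (T := T) (K := ((2 * ℓ + 1 + 4 : ℕ) : ℕ∞)) hxtop
  have hcS := hth.mem_support_of_mem_bag hxS hxc hKc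
  obtain ⟨w, hw, rfl⟩ := exists_of_mem_support_extWalk hcS
  obtain ⟨w', hw', he⟩ := hmem x hxd _ (ABT.bag_subset_subtree _ hxc)
    (by rw [hvol]; exact hKc) ((hd.mem_subtrees hxd).imp
      (fun h => ABT.mem_subtree_of_mem_bag hxc h.2 (hfree d.u_free))
      fun h => ABT.mem_subtree_of_mem_bag hxc h.2 (hfree d.v_free))
  obtain rfl := ExtVertex.orig.inj he
  exact ⟨w, hw', hw⟩

end MatchingSystem

/-! ### Maximality: a new double path from a missed augmenting path. -/

namespace MatchingSystem

open PathParity (ofNat ofNat_eq_ofNat)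
open SimpleGraph SimpleGraph.Walk

variable {V : Type*} {I : MatchingSystem V}

namespace IsThread

variable {K : ℕ} {a b : I.ExtVertex} {S : I.ext.Walk a b}

lemma reach_getVert_left (hS : IsThread K S) {i : ℕ} (hi : i ≤ S.length) :
    I.Reach (S.getVert i) (2 + i) := by
  have := hS.reach_left _ _ (S.append_take_drop_eq i).symm
  rwa [take_length, min_eq_left hi] at this

lemma reach_getVert_right (hS : IsThread K S) (i : ℕ) :
    I.Reach (S.getVert i) (2 + (S.length - i)) := by
  have := hS.reach_right _ _ (S.append_take_drop_eq i).symm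
  rwa [drop_length] at this

lemma rho_getVert (hS : IsThread K S) {i : ℕ} (hi : i < S.length) :
    I.rho (S.getVert i) (S.getVert (i + 1)) = ofNat i := by
  rw [rho_eq_ofNat, alternates_getVert hS.alternates hi, zero_add]

/-- An inner vertex of large tenacity has one of its two neighbours on the path as a parent. -/
lemma mem_parents_or (hS : IsThread K S) {i : ℕ} (hi : i + 1 < S.length)
    (hK : K ≤ I.tenacity (S.getVert (i + 1))) :
    S.getVert i ∈ I.parents (S.getVert (i + 1)) ∨
      S.getVert (i + 2) ∈ I.parents (S.getVert (i + 1)) := by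
  have hl := (hS.reach_getVert_left hi.le).dist_le
  have hr := (hS.reach_getVert_right (i + 1)).dist_le
  have hlen := hS.length
  have hodd := hS.odd
  rw [tenacity_eq (ofNat (2 + (i + 1))), PathParity.flip_ofNat] at hK
  rw [ofNat_eq_ofNat.2
    (show (2 + (S.length - (i + 1))) % 2 = (2 + (i + 1) + 1) % 2 by omega)] at hr
  obtain ⟨c, hc⟩ := ENat.ne_top_iff_exists.1 (ne_top_of_le_ne_top (ENat.natCast_ne_top _) hl)
  obtain ⟨e, he⟩ := ENat.ne_top_iff_exists.1 (ne_top_of_le_ne_top (ENat.natCast_ne_top _) hr)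
  have ho := orthDist_eq (ofNat (2 + (i + 1))) (S.getVert (i + 1))
  rw [PathParity.flip_ofNat, ← hc, ← he] at ho
  rw [← hc, ← he] at hK
  rw [← hc] at hl
  rw [← he] at hr
  have hl' : c ≤ 2 + (i + 1) := by exact_mod_cast hl
  have hr' : e ≤ 2 + (S.length - (i + 1)) := by exact_mod_cast hr
  have hK' : K ≤ c + e := by exact_mod_cast hK
  -- The two ways along S have total length K, at most c + e, so both are shortest; the shorter one
  -- ends with an edge from a parent.
  rcases lt_or_ge c e with hce | hce
  · left
    refine mem_parents_of_reach (hS.reach_getVert_left (by omega))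
      (S.adj_getVert_succ (by omega)) ?_ ?_
    · rw [hS.rho_getVert (by omega), ofNat_eq_ofNat]; omega
    · rw [ho, min_eq_left (by exact_mod_cast hce.le)]
      exact_mod_cast (by omega)
  · right
    refine mem_parents_of_reach (hS.reach_getVert_right (i + 2))
      (S.adj_getVert_succ (i := i + 1) (by omega)).symm ?_ ?_
    · rw [rho_comm, hS.rho_getVert (i := i + 1) (by omega), ofNat_eq_ofNat]; omega
    · rw [ho, min_eq_right (by exact_mod_cast hce)]
      exact_mod_cast (by omega)

/-- `c` is a neighbour of `x` on the path and a possible parent of `x`. -/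
def ParentOn (S : I.ext.Walk a b) (x c : I.ExtVertex) : Prop :=
  c ∈ I.parents x ∧ ∃ i < S.length,
    (S.getVert i = x ∧ S.getVert (i + 1) = c) ∨ (S.getVert (i + 1) = x ∧ S.getVert i = c)

/-- All parent edges of x have the same ρ, fixed by its orthodox parity, whereas the two edges of S
at x differ in ρ. -/
lemma parentOn_unique (hS : IsThread K S) {x c c' : I.ExtVertex} (h : ParentOn S x c)
    (h' : ParentOn S x c') : c = c' := by
  obtain ⟨hc, i, hi, hx⟩ := h
  obtain ⟨hc', j, hj, hx'⟩ := h'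
  have hrho : I.rho c x = I.rho c' x := by
    obtain ⟨n, -, h1, -, h2⟩ := mem_parents_iff.1 hc
    obtain ⟨n', -, h1', -, h2'⟩ := mem_parents_iff.1 hc'
    rw [h2] at h2'
    have : n + 1 = n' + 1 := by exact_mod_cast h2'
    rw [h1, h1', ofNat_eq_ofNat]
    omega
  have hinj : ∀ {i j : ℕ}, i ≤ S.length → j ≤ S.length → S.getVert i = S.getVert j → i = j :=
    fun hi hj h => hS.isPath.getVert_injOn hi hj h
  rcases hx with ⟨rfl, rfl⟩ | ⟨rfl, rfl⟩ <;> rcases hx' with ⟨h, rfl⟩ | ⟨h, rfl⟩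
  · rw [hinj hj.le hi.le h]
  · have := hinj (by omega) (by omega) h
    subst this
    rw [rho_comm, hS.rho_getVert hi, hS.rho_getVert hj, ofNat_eq_ofNat] at hrho
    omega
  · have := hinj (by omega) (by omega) h
    subst this
    rw [hS.rho_getVert hi, rho_comm, hS.rho_getVert hj, ofNat_eq_ofNat] at hrho
    omega
  · have := hinj (by omega) (by omega) h
    have : j = i := by omega
    rw [this]

/-- In an alternating base tree that follows the path, each vertex of the path lies below one of the
two ends. -/
lemma mem_subtree_or (hS : IsThread K S) {T : I.ABT}
    (hT : ∀ x c, ParentOn S x c → T.IsParent x c) {x : I.ExtVertex} (hx : x ∈ S.support) :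
    x ∈ T.subtree a ∨ x ∈ T.subtree b := by
  have htop : ∀ {x}, x ∈ S.support → I.orthDist x ≠ ⊤ := fun hx => by
    obtain ⟨p, q, hpq⟩ := mem_support_iff_exists_append.1 hx
    exact ne_top_of_le_ne_top (ENat.natCast_ne_top _) (hS.reach_left p q hpq).orthDist_le
  obtain ⟨n, hn⟩ := ENat.ne_top_iff_exists.1 (htop hx)
  induction n using Nat.strong_induction_on generalizing x with
  | _ n ih =>
  -- Climb from x to the base c, which is back on S. Either c is an end, or the tree follows S from
  -- c to a vertex of smaller orthodox distance.
  obtain ⟨c, hxc, hc⟩ := ABT.exists_mem_bag (T := T) (K := K) (htop hx)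
  have hcS := hS.mem_support_of_mem_bag hx hxc hc
  have hxc' := ABT.bag_subset_subtree _ hxc
  obtain ⟨i, rfl, hi⟩ := mem_support_iff_exists_getVert.1 hcS
  have step : ∀ w ∈ S.support, ParentOn S (S.getVert i) w → x ∈ T.subtree a ∨ x ∈ T.subtree b := by
    intro w hw hpo
    have hp := hT _ _ hpo
    have hlt := hp.orthDist_lt.trans_le (ABT.orthDist_le_of_mem_subtree hxc')
    obtain ⟨k, hk⟩ := ENat.ne_top_iff_exists.1 (htop hw)
    rw [← hk, ← hn] at hlt
    exact (ih k (by exact_mod_cast hlt) hw hk).imp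
      (fun h => ABT.subtree_subset (hp.mem_subtree h) hxc')
      fun h => ABT.subtree_subset (hp.mem_subtree h) hxc'
  rcases i with _ | i
  · rw [getVert_zero] at hxc'
    exact Or.inl hxc'
  rcases hi.lt_or_eq with hi | hi
  · rcases hS.mem_parents_or hi hc with h | h
    · exact step _ (S.getVert_mem_support _) ⟨h, i, by omega, Or.inr ⟨rfl, rfl⟩⟩
    · exact step _ (S.getVert_mem_support _) ⟨h, i + 1, hi, Or.inl ⟨rfl, rfl⟩⟩
  · rw [hi, getVert_length] at hxc'
    exact Or.inr hxc'

/-- After redirecting an alternating base tree along a shortest augmenting path, this path has a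
critical edge of minimum volume between the subtrees of its two ends. -/
theorem exists_critical_edge (hS : IsThread K S) (T : I.ABT) :
    ∃ T' : I.ABT, (∀ x ∉ S.support, T'.parent x = T.parent x) ∧
      (Disjoint (T'.subtree a) (T'.subtree b) → ∃ y z, y ∈ S.support ∧ z ∈ S.support ∧
        I.ext.Adj y z ∧ y ∈ T'.subtree a ∧ z ∈ T'.subtree b ∧ I.volume y z = K ∧
        y ∉ I.parents z ∧ z ∉ I.parents y) := by
  obtain ⟨T', hT', hTT'⟩ := exists_abt_of_rel T (ParentOn S) (fun _ _ h => h.1)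
    fun _ _ _ h h' => hS.parentOn_unique h h'
  refine ⟨T', fun x hx => hTT' x fun c ⟨_, i, hi, h⟩ => hx ?_, fun hdisj => ?_⟩
  · rcases h with ⟨rfl, -⟩ | ⟨rfl, -⟩ <;> exact S.getVert_mem_support _
  have hdis : ∀ {x}, x ∈ T'.subtree a → x ∉ T'.subtree b := fun h => Set.disjoint_left.1 hdisj h
  obtain ⟨y, z, q, h, r, heq, hz, hq⟩ := exists_first_exit (T'.subtree a) S
    (ABT.mem_subtree_self a) fun h => hdis h (ABT.mem_subtree_self b)
  have hy := hq y q.end_mem_support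
  have hyS : y ∈ S.support := by rw [heq]; simp [mem_support_append_iff]
  have hzS : z ∈ S.support := by rw [heq]; simp [mem_support_append_iff]
  have hzb : z ∈ T'.subtree b := (hS.mem_subtree_or hT' hzS).resolve_left hz
  have hnyz : ¬ T'.IsParent y z := fun hp => hdis hy (hp.mem_subtree hzb)
  have hnzy : ¬ T'.IsParent z y := fun hp => hz (hp.mem_subtree hy)
  have hlen := hS.length
  have hodd := hS.odd
  have hly : q.length < S.length := by rw [heq]; simp
  have hgy : S.getVert q.length = y := by rw [heq, getVert_append]; simp
  have hgz : S.getVert (q.length + 1) = z := by rw [heq, getVert_append]; simp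
  have hry := hS.reach_getVert_left hly.le
  have hrz := hS.reach_getVert_right (q.length + 1)
  have hrho := hS.rho_getVert hly
  rw [hgy] at hry hrho
  rw [hgz] at hrz hrho
  -- The ways along S bound the volume above; being incoming at a, of tenacity at least K, bounds it
  -- below. The edge is critical since T' would otherwise contain it.
  refine ⟨y, z, hyS, hzS, h, hy, hzb, le_antisymm ?_ ?_, fun hp => ?_, fun hp => ?_⟩
  · rw [volume, hrho]
    have h1 := hry.dist_le
    have h2 := hrz.dist_le
    rw [ofNat_eq_ofNat.2 (show (2 + q.length) % 2 = q.length % 2 by omega)] at h1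
    rw [ofNat_eq_ofNat.2
      (show (2 + (S.length - (q.length + 1))) % 2 = q.length % 2 by omega)] at h2
    refine (add_le_add (add_le_add h1 h2) le_rfl).trans ?_
    exact_mod_cast (by omega)
  · rw [volume_comm]
    refine hS.tenacity_fst.trans (ABT.tenacity_le_of_isIncoming (T := T') ?_
      ⟨h.symm, hy, hz, hnzy, hnyz⟩)
    have := (hS.reach_getVert_left (Nat.zero_le _)).orthDist_le
    rw [getVert_zero] at this
    exact ne_top_of_le_ne_top (ENat.natCast_ne_top _) this
  · exact hnzy (hT' _ _ ⟨hp, q.length, hly, Or.inr ⟨hgz, hgy⟩⟩)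
  · exact hnyz (hT' _ _ ⟨hp, q.length, hly, Or.inl ⟨hgy, hgz⟩⟩)

end IsThread

/-- A shortest augmenting path that does not meet the members of `D` yields a double path that does
not meet them either. -/
theorem exists_doublePath {D : Set I.DoublePath} {T : I.ABT} (hT : ∀ d ∈ D, T.Respects d)
    {r : I.AnyWalk} (hr : I.IsShortestAugmentingPath r.walk)
    (hD : ∀ d ∈ D, Disjoint d.verts r.verts) :
    ∃ d' : I.DoublePath, ∀ d ∈ D, Disjoint d.verts d'.verts := by
  have hodd := hr.1.alternates.2.2
  obtain ⟨-, hne, hu, hv⟩ := hr.1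
  obtain ⟨T', hT', hcrit⟩ := hr.isThread.exists_critical_edge T
  obtain ⟨y, z, hyS, hzS, hadj, hy, hz, hvol, hyz, hzy⟩ := hcrit
    (Set.disjoint_left.2 fun x h h' => hne (ABT.eq_of_mem_subtrees hu hv h h'))
  obtain ⟨y, hyr, rfl⟩ := exists_of_mem_support_extWalk hyS
  obtain ⟨z, hzr, rfl⟩ := exists_of_mem_support_extWalk hzS
  obtain ⟨P, hP, hPd⟩ := ABT.exists_treePath hy
  obtain ⟨Q, hQ, hQd⟩ := ABT.exists_treePath hz
  have hdag : ∀ {e : I.graph.Dart}, T'.IsParent (.orig e.fst) (.orig e.snd) →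
      I.baseDAG.Adj e.fst e.snd := fun h =>
    ⟨fun hf => ABT.not_isParent_of_free hf h, h.mem_parents⟩
  have hPs : ∀ {x}, x ∈ P.support → (.orig x : I.ExtVertex) ∈ T'.subtree (.orig r.src) :=
    fun hx => (ABT.mem_subtrees_of_mem_support hPd hx).2
  have hQs : ∀ {x}, x ∈ Q.support → (.orig x : I.ExtVertex) ∈ T'.subtree (.orig r.tgt) :=
    fun hx => (ABT.mem_subtrees_of_mem_support hQd hx).2
  refine ⟨⟨y, z, r.src, r.tgt, P, Q, ?_, ⟨hyz, hzy⟩, hP, hQ, fun e he => hdag (hPd e he),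
    fun e he => hdag (hQd e he), hu, hv, hne,
    fun x h h' => hne (ABT.eq_of_mem_subtrees hu hv (hPs h) (hQs h'))⟩, fun d hd => ?_⟩
  · refine ⟨hadj, ⟨r.walk.length / 2, ⟨r.src, r.tgt, r.walk, hr, by omega⟩, ?_⟩,
      T', r.src, r.tgt, ⟨hu, hy⟩, ⟨hv, hz⟩, hne⟩
    rw [hvol]
    congr 1
    omega
  -- T' differs from T only on r, which avoids d.
  · have hresp : T'.Respects d := by
      have key : ∀ {e : I.graph.Dart}, d.IsDart e → T.IsParent (.orig e.fst) (.orig e.snd) →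
          T'.IsParent (.orig e.fst) (.orig e.snd) := fun he h =>
        ⟨h.1, (hT' _ fun hx => Set.disjoint_left.1 (hD d hd) he.mem_verts
          (mem_support_extWalk.1 hx)).trans h.2⟩
      exact ⟨fun e he => key (Or.inl he) ((hT d hd).1 e he),
        fun e he => key (Or.inr he) ((hT d hd).2 e he)⟩
    have hsrc : r.src ∈ r.verts := r.walk.start_mem_support
    have htgt : r.tgt ∈ r.verts := r.walk.end_mem_support
    have hdu : d.u ∈ d.verts := Or.inl d.P.end_mem_support
    have hdv : d.v ∈ d.verts := Or.inr d.Q.end_mem_support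
    have hne' : ∀ {w w' : V}, w ∈ d.verts → w' ∈ r.verts → w ≠ w' := fun h h' he =>
      Set.disjoint_left.1 (hD d hd) h (he ▸ h')
    -- A common vertex would lie in the tree of an end of d and in that of an end of r, which are
    -- different free vertices.
    refine Set.disjoint_left.2 fun x hx hx' => ?_
    rcases hresp.mem_subtrees hx with ⟨-, h⟩ | ⟨-, h⟩ <;> rcases hx' with h' | h'
    · exact hne' hdu hsrc (ABT.eq_of_mem_subtrees d.u_free hu h (hPs h'))
    · exact hne' hdu htgt (ABT.eq_of_mem_subtrees d.u_free hv h (hQs h'))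
    · exact hne' hdv hsrc (ABT.eq_of_mem_subtrees d.v_free hu h (hPs h'))
    · exact hne' hdv htgt (ABT.eq_of_mem_subtrees d.v_free hv h (hQs h'))

/-- The outputs of DoubleToAug are vertex-disjoint shortest augmenting paths. -/
theorem isDisjointShortestAugmentingPaths_aug {D : Set I.DoublePath}
    (hD : I.IsDisjointDoublePaths D) {T : I.ABT} (hT : ∀ d ∈ D, T.Respects d)
    {m : I.ExtVertex → I.ExtVertex × I.ExtVertex} (hm : T.IsMIEChoice m) :
    I.IsDisjointShortestAugmentingPaths (Aug T m D) := by
  constructor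
  · rintro q ⟨d, hd, hq⟩
    obtain ⟨q', hq', hs, -⟩ := exists_doubleToAug hm (hT d hd)
    rwa [hq.unique hq']
  · rintro q ⟨d, hd, hq⟩ q' ⟨d', hd', hq'⟩ hne
    have hdd : d ≠ d' := by
      rintro rfl
      exact hne (hq.unique hq')
    have hdis : ∀ {x}, x ∈ d.verts → x ∉ d'.verts :=
      fun h => Set.disjoint_left.1 (hD hd hd' hdd) h
    have hu : d.u ∈ d.verts := Or.inl d.P.end_mem_support
    have hv : d.v ∈ d.verts := Or.inr d.Q.end_mem_support
    have hu' : d'.u ∈ d'.verts := Or.inl d'.P.end_mem_support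
    have hv' : d'.v ∈ d'.verts := Or.inr d'.Q.end_mem_support
    have hne' : ∀ {w w' : V}, w ∈ d.verts → w' ∈ d'.verts → w ≠ w' := fun h h' he =>
      hdis h (he ▸ h')
    obtain ⟨p, hp, -, -, -, hs, -⟩ := exists_doubleToAug hm (hT d hd)
    obtain ⟨p', hp', -, -, -, hs', -⟩ := exists_doubleToAug hm (hT d' hd')
    obtain rfl := hq.unique hp
    obtain rfl := hq'.unique hp'
    refine Set.disjoint_left.2 fun x hx hx' => ?_
    rcases hs x hx with h | h <;> rcases hs' x hx' with h' | h'
    · exact hne' hu hu' (ABT.eq_of_mem_subtrees d.u_free d'.u_free h h')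
    · exact hne' hu hv' (ABT.eq_of_mem_subtrees d.u_free d'.v_free h h')
    · exact hne' hv hu' (ABT.eq_of_mem_subtrees d.v_free d'.u_free h h')
    · exact hne' hv hv' (ABT.eq_of_mem_subtrees d.v_free d'.v_free h h')

end MatchingSystem

/-! ### Assembly. -/

theorem theorem1 {V : Type*} [Finite V] (I : MatchingSystem V) (D : Set I.DoublePath)
    (hD : Maximal I.IsDisjointDoublePaths D) :
    (∃ T : I.ABT, ∀ d ∈ D, T.Respects d) ∧
    ∀ T : I.ABT, (∀ d ∈ D, T.Respects d) →
      ∀ m : I.ExtVertex → I.ExtVertex × I.ExtVertex, T.IsMIEChoice m →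
        (∀ d ∈ D, ∃ q : I.AnyWalk, MatchingSystem.DoubleToAug T m d q) ∧
        Maximal I.IsDisjointShortestAugmentingPaths (MatchingSystem.Aug T m D) := by
  refine ⟨hD.prop.exists_respects, fun T hT m hm => ⟨fun d hd => ?_, ?_, ?_⟩⟩
  · obtain ⟨q, hq, -⟩ := MatchingSystem.exists_doubleToAug hm (hT d hd)
    exact ⟨q, hq⟩
  · exact MatchingSystem.isDisjointShortestAugmentingPaths_aug hD.prop hT hm
  · intro B hB hAB r hrB
    by_contra hrA
    obtain ⟨d', hd'⟩ := MatchingSystem.exists_doublePath hT (hB.1 r hrB) fun d hd => by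
      obtain ⟨q, hq, -⟩ := MatchingSystem.exists_doubleToAug hm (hT d hd)
      have hqA : q ∈ MatchingSystem.Aug T m D := ⟨d, hd, hq⟩
      refine Set.disjoint_left.2 fun x hxd hxr => ?_
      obtain ⟨w, hw, hwr⟩ :=
        MatchingSystem.exists_mem_of_mem_verts hm (hT d hd) hq (hB.1 r hrB) hxd hxr
      refine Set.disjoint_left.1 (hB.2 (hAB hqA) hrB ?_) hw hwr
      rintro rfl
      exact hrA hqA
    have hins : I.IsDisjointDoublePaths (insert d' D) := by
      unfold MatchingSystem.IsDisjointDoublePaths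
      rw [Set.pairwiseDisjoint_insert]
      exact ⟨hD.prop, fun d hd _ => (hd' d hd).symm⟩
    -- Maximality puts d' into D, so d' is disjoint from itself, although it has a vertex.
    have hmem : d' ∈ D := hD.le_of_ge hins (Set.subset_insert d' D) (Set.mem_insert d' D)
    have hu : d'.u ∈ d'.verts := Or.inl d'.P.end_mem_support
    exact Set.disjoint_left.1 (hd' d' hmem) hu hu
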